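/- **Setting.** Let $M,L\ge 1$ and $N\ge L$ be integers. For a dictionary $d=(d_1,\dots,d_M)\in\mathbb R^{ML}$, $d_m\in\mathbb R^L$, and coefficient maps $x=(x_1,\dots,x_M)\in\mathbb R^{MN}$, $x_m\in\mathbb R^N$, write $Xd=\sum_m d_m*x_m\in\mathbb R^N$ (circular convolution, $d_m$ zero-padded to length $N$). For $\lambda>0$ and a signal $s\in\mathbb R^N$ put $$l(d,x;s)=\tfrac12\|Xd-s\|_2^2+\lambda\|x\|_1,\qquad f(d;s)=\min_x l(d,x;s),$$ $$F(d)=\mathbb E_{s\sim P_S}[f(d;s)],\qquad C=\{d:\|d_m\|_2\le 1\ \forall m\}.$$ Let $V$ be the set of stationary points of $\min_{d\in C}F(d)$, i.e. of those $d\in C$ at which $F$ is differentiable and $\langle\nabla F(d),e-d\rangle\ge0$ for all $e\in C$. **Algorithm.** Fix $p>0$, $\eta>0$, $\tau_0>0$, $\alpha>0$ and $d^{(0)}\in C$. The signals $s^{(1)},s^{(2)},\dots$ (for instance the regions obtained by splitting larger images) are i.i.d. with law $P_S$. For $t=1,2,\dots$, let $x^{(t)}\in\arg\min_x l(d^{(t-1)},x;s^{(t)})$,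 let $$\mathcal F^{(t)}_{\rm mod}(d)=\frac1{\Lambda^{(t)}}\sum_{\tau=1}^t(\tau/t)^p\,l(d,x^{(\tau)};s^{(\tau)}),\qquad \Lambda^{(t)}=\sum_{\tau=1}^t(\tau/t)^p,$$ and obtain $d^{(t)}$ by FISTA for $\min_{d\in C}\mathcal F^{(t)}_{\rm mod}(d)$, as follows. Put $g^0=g^0_{\rm aux}=d^{(t-1)}$, $\gamma^0=1$, and for $j\ge 0$ $$g^{j+1}=\mathrm{Proj}_C\big(g^j_{\rm aux}-\eta\nabla\mathcal F^{(t)}_{\rm mod}(g^j_{\rm aux})\big),\quad \gamma^{j+1}=\tfrac{1+\sqrt{1+4(\gamma^j)^2}}2,\quad g^{j+1}_{\rm aux}=g^{j+1}+\tfrac{\gamma^j-1}{\gamma^{j+1}}(g^{j+1}-g^j).$$ FISTA stops at the first $j$ with $\|g^j_{\rm aux}-g^{j+1}\|\le\tau_0/(1+\alpha t)$ and returns $d^{(t)}=g^{j+1}$. The gradient is computed from recursively updated accumulators with forgetting factor $\alpha^{(t)}=(1-1/t)^p$, either in the spatial domain, $$\nabla\mathcal F^{(t)}_{\rm mod}(g)=\tfrac1{\Lambda^{(t)}}(A^{(t)}g-b^{(t)}),\quad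 A^{(t)}=\alpha^{(t)}A^{(t-1)}+(X^{(t)})^TX^{(t)},\quad b^{(t)}=\alpha^{(t)}b^{(t-1)}+(X^{(t)})^Ts^{(t)},$$ with $A^{(0)}=0$, $b^{(0)}=0$, or by the same formulas in the frequency domain, applied to the discrete Fourier transforms of the zero-padded filters, the coefficient maps and the signals, followed by the inverse transform and restriction to the support of the filters. **Assumptions.** (The sequences are generated by the algorithm almost surely; in particular each inner FISTA loop stops.) 1. $P_S$ has compact support. 2. Sparse coding has a unique solution, uniformly: there is $\kappa>0$ such that, almost surely, for all $s\in\mathrm{supp}\,P_S$ and all dictionaries $d$ in the closure of $\{d^{(t)}:t\ge 0\}$, the problem $\min_x l(d,x;s)$ has a unique solution $x^*$, and $\sigma_{\min}(D_\Lambda^TD_\Lambda)\ge\kappa$, where $D$ is the linear map $v\mapsto\sum_m d_m*v_m$ and $D_\Lambda$ its restriction to the vectors supported on $\Lambda=\{i:x^*_i\ne 0\}$ (no condition if $\Lambda=\emptyset$). 3. The surrogates are uniformly strongly convex: there is $\mu>0$ such that, almost surely, $\langle\nabla\mathcal F^{(t)}_{\rm mod}(d)-\nabla\mathcal F^{(t)}_{\rm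 mod}(\tilde d),d-\tilde d\rangle\ge\mu\|d-\tilde d\|^2$ for all $t\ge1$ and all $d,\tilde d\in\mathbb R^{ML}$. **Theorem.** With probability $1$: 1. $\mathcal F^{(t)}_{\rm mod}(d^{(t)})$ converges; 2. $\mathcal F^{(t)}_{\rm mod}(d^{(t)})-F(d^{(t)})\to0$; 3. $F(d^{(t)})$ converges; 4. $V\neq\emptyset$ and $\mathrm{dist}(d^{(t)},V)\to0$. -/

import Mathlib

open MeasureTheory ProbabilityTheory Filter Topology
open scoped Gradient RealInnerProductSpace

noncomputable section

namespace OCDL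

/-- Signals `s ∈ ℝ^N`, indexed cyclically (circular boundary conditions). -/
abbrev Signal (N : ℕ) := EuclideanSpace ℝ (ZMod N)

/-- Dictionaries `d = (d_1, …, d_M) ∈ ℝ^{ML}`, each filter `d_m` in `ℝ^L`. -/
abbrev Dict (M L : ℕ) := EuclideanSpace ℝ (Fin M × Fin L)

/-- Coefficient maps `x = (x_1, …, x_M) ∈ ℝ^{MN}`, each map `x_m` in `ℝ^N`. -/
abbrev Coef (M N : ℕ) := EuclideanSpace ℝ (Fin M × ZMod N)

variable {N M L : ℕ}

/-- The circular convolution sum `∑_m d_m ∗ x_m` (filters zero-padded from length `L` to `N`). -/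
def convSum (d : Dict M L) (x : Coef M N) : Signal N :=
  WithLp.toLp 2 fun i => ∑ m : Fin M, ∑ l : Fin L, d (m, l) * x (m, i - ((l : ℕ) : ZMod N))

/-- The matrix of the linear operator `X : ℝ^{ML} → ℝ^N`, `X d = ∑_m d_m ∗ x_m`. -/
def operatorX (L : ℕ) (x : Coef M N) : Matrix (ZMod N) (Fin M × Fin L) ℝ :=
  fun i q => x (q.1, i - ((q.2 : ℕ) : ZMod N))

/-- The loss `l(d, x; s) = (1/2) ‖∑_m d_m ∗ x_m - s‖₂² + lam ‖x‖₁`. -/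
def loss [NeZero N] (lam : ℝ) (d : Dict M L) (x : Coef M N) (s : Signal N) : ℝ :=
  (1 / 2) * ‖convSum d x - s‖ ^ 2 + lam * ∑ q, |x q|

/-- `x` solves the convolutional sparse coding problem `min_x l(d, x; s)`. -/
def IsSparseCode [NeZero N] (lam : ℝ) (d : Dict M L) (s : Signal N) (x : Coef M N) : Prop :=
  ∀ y : Coef M N, loss lam d x s ≤ loss lam d y s

/-- `f(d; s) = min_x l(d, x; s)`. -/
def minLoss [NeZero N] (lam : ℝ) (d : Dict M L) (s : Signal N) : ℝ :=
  ⨅ x : Coef M N, loss lam d x s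

/-- The expected objective `F(d) = E_{s ∼ PS} f(d; s)`. -/
def expectedLoss [NeZero N] (lam : ℝ) (PS : Measure (Signal N)) (d : Dict M L) : ℝ :=
  ∫ s, minLoss lam d s ∂PS

/-- The constraint set `C = {d | ‖d_m‖² ≤ 1 for all m}`. -/
def constraintSet (M L : ℕ) : Set (Dict M L) :=
  {d | ∀ m : Fin M, ∑ l : Fin L, d (m, l) ^ 2 ≤ 1}

/-- Stationary points of `min_{d ∈ C} F(d)`. Differentiability is demanded explicitly, since the
`gradient` of a function that is not differentiable is `0` by convention. -/
def stationaryPoints [NeZero N] (lam : ℝ) (PS : Measure (Signal N)) : Set (Dict M L) :=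
  {d | d ∈ constraintSet M L ∧ DifferentiableAt ℝ (expectedLoss lam PS) d ∧
    ∀ e ∈ constraintSet M L, 0 ≤ ⟪∇ (expectedLoss lam PS) d, e - d⟫}

/-- `D_Λᵀ D_Λ ≥ κ` in the sense of smallest eigenvalues (equivalently singular values), where
`D v = ∑_m d_m ∗ v_m` and `Λ` is the set of indices of the non-zero entries of `x`. -/
def GramBound [NeZero N] (κ : ℝ) (d : Dict M L) (x : Coef M N) : Prop :=
  ∀ v : Coef M N, (∀ q, x q = 0 → v q = 0) → κ * ‖v‖ ^ 2 ≤ ‖convSum d v‖ ^ 2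

/-! ### The weighted surrogate functions -/

/-- `Λ^{(t)} = ∑_{τ=1}^t (τ/t)^p`. -/
def weightSum (p : ℝ) (t : ℕ) : ℝ :=
  ∑ τ ∈ Finset.Icc 1 t, ((τ : ℝ) / (t : ℝ)) ^ p

/-- The forgetting factor `α^{(t)} = (1 - 1/t)^p`. -/
def forget (p : ℝ) (t : ℕ) : ℝ := (1 - 1 / (t : ℝ)) ^ p

/-- The weighted surrogate `(1/Λ^{(t)}) ∑_{τ=1}^t (τ/t)^p l(d, x^{(τ)}; s^{(τ)})`. -/
def surrogate [NeZero N] (lam p : ℝ) (s : ℕ → Signal N) (x : ℕ → Coef M N) (t : ℕ)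
    (d : Dict M L) : ℝ :=
  (1 / weightSum p t) *
    ∑ τ ∈ Finset.Icc 1 t, ((τ : ℝ) / (t : ℝ)) ^ p * loss lam d (x τ) (s τ)

/-! ### Spatial-domain accumulators and gradient step -/

/-- `A^{(t)} = α^{(t)} A^{(t-1)} + X^{(t)ᵀ} X^{(t)}`, `A^{(0)} = 0`. -/
def accA [NeZero N] (L : ℕ) (p : ℝ) (x : ℕ → Coef M N) :
    ℕ → Matrix (Fin M × Fin L) (Fin M × Fin L) ℝ
  | 0 => 0
  | t + 1 => forget p (t + 1) • accA L p x t +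
      (operatorX L (x (t + 1))).transpose * operatorX L (x (t + 1))

/-- `b^{(t)} = α^{(t)} b^{(t-1)} + X^{(t)ᵀ} s^{(t)}`, `b^{(0)} = 0`. -/
def accB [NeZero N] (L : ℕ) (p : ℝ) (s : ℕ → Signal N) (x : ℕ → Coef M N) :
    ℕ → (Fin M × Fin L → ℝ)
  | 0 => 0
  | t + 1 => forget p (t + 1) • accB L p s x t +
      (operatorX L (x (t + 1))).transpose.mulVec (fun i => s (t + 1) i)

/-- The step `g ↦ g - η (A^{(t)} g - b^{(t)}) / Λ^{(t)}`. -/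
def spatialStep [NeZero N] (p η : ℝ) (s : ℕ → Signal N) (x : ℕ → Coef M N) (t : ℕ)
    (g : Dict M L) : Dict M L :=
  g - η • (1 / weightSum p t) •
    WithLp.toLp 2 ((accA L p x t).mulVec (fun q => g q) - accB L p s x t)

/-! ### Frequency-domain accumulators and gradient step -/

/-- The zero-padding of the `m`-th filter from `ℝ^L` to `ℝ^N`. -/
def pad (N : ℕ) (g : Dict M L) (m : Fin M) (i : ZMod N) : ℝ :=
  if h : i.val < L then g (m, ⟨i.val, h⟩) else 0

/-- `ĝ`: the discrete Fourier transforms of the zero-padded filters. -/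
def dictHat (N : ℕ) [NeZero N] (g : Dict M L) : Fin M × ZMod N → ℂ :=
  fun q => ZMod.dft (fun i : ZMod N => ((pad N g q.1 i : ℝ) : ℂ)) q.2

/-- `ŝ`: the discrete Fourier transform of a signal. -/
def signalHat [NeZero N] (s : Signal N) : ZMod N → ℂ :=
  ZMod.dft (fun i : ZMod N => ((s i : ℝ) : ℂ))

/-- `X̂ = (X̂_1 … X̂_M)`, where `X̂_m` is diagonal with the Fourier transform of `x_m` on its
diagonal, so that `X̂ d̂ = ∑_m d̂_m ⊙ x̂_m`. -/
def operatorXHat [NeZero N] (x : Coef M N) : Matrix (ZMod N) (Fin M × ZMod N) ℂ :=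
  fun k q => if k = q.2 then ZMod.dft (fun i : ZMod N => ((x (q.1, i) : ℝ) : ℂ)) k else 0

/-- `Â^{(t)} = α^{(t)} Â^{(t-1)} + X̂^{(t)ᴴ} X̂^{(t)}`, `Â^{(0)} = 0`. -/
def accAHat [NeZero N] (p : ℝ) (x : ℕ → Coef M N) :
    ℕ → Matrix (Fin M × ZMod N) (Fin M × ZMod N) ℂ
  | 0 => 0
  | t + 1 => (forget p (t + 1) : ℂ) • accAHat p x t +
      (operatorXHat (x (t + 1))).conjTranspose * operatorXHat (x (t + 1))

/-- `b̂^{(t)} = α^{(t)} b̂^{(t-1)} + X̂^{(t)ᴴ} ŝ^{(t)}`, `b̂^{(0)} = 0`. -/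
def accBHat [NeZero N] (p : ℝ) (s : ℕ → Signal N) (x : ℕ → Coef M N) :
    ℕ → (Fin M × ZMod N → ℂ)
  | 0 => 0
  | t + 1 => (forget p (t + 1) : ℂ) • accBHat p s x t +
      (operatorXHat (x (t + 1))).conjTranspose.mulVec (signalHat (s (t + 1)))

/-- The gradient step computed in the frequency domain: `IFFT (ĝ - η (Â^{(t)} ĝ - b̂^{(t)}) / Λ^{(t)})`,
cropped to the support of the filters (the support part of the projection onto
`C_PN = {zero-padded elements of C}`; the norm part is the projection onto `C`). -/
def freqStep [NeZero N] (p η : ℝ) (s : ℕ → Signal N) (x : ℕ → Coef M N) (t : ℕ)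
    (g : Dict M L) : Dict M L :=
  WithLp.toLp 2 fun q =>
    (ZMod.dft.symm (fun k : ZMod N =>
      (dictHat N g - ((η * (1 / weightSum p t) : ℝ) : ℂ) •
        ((accAHat p x t).mulVec (dictHat N g) - accBHat p s x t)) (q.1, k))
      ((q.2 : ℕ) : ZMod N)).re

/-! ### FISTA with the fixed-point-residual stopping rule -/

/-- The nearest point of `S` to `y` (used for a non-empty closed convex set `S` only). -/
def metricProj {E : Type*} [NormedAddCommGroup E] (S : Set E) (y : E) : E :=
  Classical.epsilon fun z => z ∈ S ∧ ∀ w ∈ S, ‖y - z‖ ≤ ‖y - w‖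

/-- `γ^0 = 1`, `γ^{j+1} = (1 + √(1 + 4 (γ^j)²)) / 2`. -/
def fistaGamma : ℕ → ℝ
  | 0 => 1
  | j + 1 => (1 + Real.sqrt (1 + 4 * fistaGamma j ^ 2)) / 2

/-- The FISTA pair `(g^j, g^j_aux)` for the projected gradient map `T`, started at `g0`:
`g^{j+1} = T g^j_aux` and `g^{j+1}_aux = g^{j+1} + ((γ^j - 1)/γ^{j+1}) (g^{j+1} - g^j)`. -/
def fista {E : Type*} [NormedAddCommGroup E] [NormedSpace ℝ E] (T : E → E) (g0 : E) : ℕ → E × E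
  | 0 => (g0, g0)
  | j + 1 =>
    let gnew := T (fista T g0 j).2
    (gnew, gnew + ((fistaGamma j - 1) / fistaGamma (j + 1)) • (gnew - (fista T g0 j).1))

/-- FISTA stops at the first `j` at which the fixed point residual `‖g^j_aux - T g^j_aux‖` is at
most `tol`, and returns the last iterate `g^{j+1} = T g^j_aux`; `out` is the value returned. -/
def FistaOutput {E : Type*} [NormedAddCommGroup E] [NormedSpace ℝ E] (T : E → E) (tol : ℝ)
    (g0 out : E) : Prop :=
  ∃ j : ℕ, (∀ i < j, tol < ‖(fista T g0 i).2 - T (fista T g0 i).2‖) ∧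
    ‖(fista T g0 j).2 - T (fista T g0 j).2‖ ≤ tol ∧ out = (fista T g0 (j + 1)).1

/-! ### The algorithm -/

/-- The two variants of the dictionary update. -/
inductive UpdateOption
  | spatial
  | frequency

/-- The gradient step of the chosen variant. -/
def gradStep [NeZero N] (opt : UpdateOption) (p η : ℝ) (s : ℕ → Signal N) (x : ℕ → Coef M N)
    (t : ℕ) (g : Dict M L) : Dict M L :=
  match opt with
  | .spatial => spatialStep p η s x t g
  | .frequency => freqStep p η s x t g

/-- `(x^{(t)})_{t ≥ 1}` and `(d^{(t)})_{t ≥ 0}` are generated by the online algorithm from the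
samples `(s^{(t)})_{t ≥ 1}`: `x^{(t)}` solves the sparse coding problem for `d^{(t-1)}` and
`s^{(t)}`, and `d^{(t)}` is returned by FISTA on the `t`-th surrogate over `C`, warm-started at
`d^{(t-1)}` and stopped with tolerance `τ₀ / (1 + α t)`. -/
structure IsRun [NeZero N] (opt : UpdateOption) (lam p η τ₀ α : ℝ) (d0 : Dict M L)
    (s : ℕ → Signal N) (x : ℕ → Coef M N) (d : ℕ → Dict M L) : Prop where
  init : d 0 = d0
  code : ∀ t : ℕ, IsSparseCode lam (d t) (s (t + 1)) (x (t + 1))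
  update : ∀ t : ℕ,
    FistaOutput (fun g => metricProj (constraintSet M L) (gradStep opt p η s x (t + 1) g))
      (τ₀ / (1 + α * ((t + 1 : ℕ) : ℝ))) (d t) (d (t + 1))

end OCDL

end

open OCDL

/-!
The proof is deterministic apart from one uniform law of large numbers; no measurability of the
iterates and no martingale argument is used.

Write `ū_t(d)` for the surrogate, `f_t(d)` for the same weighted mean with `minLoss` in place of the
loss at the stored codes, and `F` for the expected loss. Then `f_t ≤ ū_t`, and the sample that
arrives at time `t + 1` contributes equally to both at `d_t`. FISTA returns an approximate minimizer
of the surrogate: its output satisfies the variational inequality over the constraint set up to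
`O(1 / t)` (`FistaOutput.approx_stationary`; the frequency-domain step is the same gradient step by
the convolution theorem, `freqStep_eq`). Strong convexity therefore makes consecutive dictionaries
`O(1 / t)` close (`SurrogateRun.dist_succ_le`).

Consider the times `T_k = (k + 1) ^ a`. Between `T_k` and `T_{k+1}` a proportion `w_k ≍ 1 / k` of the
weight is renewed and the dictionary moves by `O(1 / k)`. Comparing the new surrogate at its
approximate minimizer with its value at `d_{T_k}` gives, with `h_k = ū(d) - f(d) ≥ 0` at time `T_k`,
`u_{k+1} ≤ u_k - w_k h_k + (f_{T_{k+1}} - f_{T_k})(d_{T_k}) + O(1 / k ^ 2)`.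
If `a` is large, the middle term is summable: along such sparse times a grid argument with second
moments gives `∑_k sup_d |f_{T_k}(d) - F(d)| < ∞` almost surely (`uniform_lln`). Hence `u_k` converges
and `∑ h_k / k < ∞`, which with `|h_{k+1} - h_k| = O(1 / k)` forces `h_k → 0`
(`tendsto_of_almost_decreasing`). Increments of order `1 / t` carry the limits from the times `T_k`
to all times (`tendsto_of_tendsto_blocks`).

Uniqueness of the sparse codes makes them continuous in the signal and in the dictionary, so by the
envelope theorem and dominated convergence `F` is differentiable at every cluster point of the
trajectory (`differentiableAt_expectedLoss`). Since the surrogates majorize `F` up to a vanishing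
error, touch it asymptotically at the iterates and have bounded curvature, the approximate
variational inequality passes to the limit, and cluster points are stationary
(`SurrogateRun.stationary_of_cluster`). Compactness of the constraint set gives the rest.
-/

namespace OCDL

noncomputable section

/-! ### Weighted means with polynomial weights -/

/-- The weighted mean `(1 / Λ^{(t)}) ∑_{τ = 1}^t (τ / t)^p a_τ` of the first `t` terms of a
sequence of vectors. -/
def wavg {E : Type*} [AddCommGroup E] [Module ℝ E] (p : ℝ) (t : ℕ) (a : ℕ → E) : E :=
  (1 / weightSum p t) • ∑ τ ∈ Finset.Icc 1 t, ((τ : ℝ) / (t : ℝ)) ^ p • a τ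

lemma weight_nonneg (p : ℝ) (τ t : ℕ) : 0 ≤ ((τ : ℝ) / (t : ℝ)) ^ p := by positivity

lemma weightSum_ge {p : ℝ} (hp : 0 < p) (t : ℕ) : (2 : ℝ) ^ (-(p + 1)) * t ≤ weightSum p t := by
  have h2 : (2 : ℝ) ^ (-(p + 1)) = (1 / 2) ^ p * (1 / 2) := by
    rw [one_div, Real.inv_rpow (by norm_num), Real.rpow_neg (by norm_num),
      Real.rpow_add (by norm_num), Real.rpow_one, mul_inv]
  have hsub : Finset.Icc (t / 2 + 1) t ⊆ Finset.Icc 1 t :=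
    Finset.Icc_subset_Icc (by omega) le_rfl
  calc (2 : ℝ) ^ (-(p + 1)) * t
      ≤ ∑ τ ∈ Finset.Icc (t / 2 + 1) t, (1 / 2 : ℝ) ^ p := by
        rw [Finset.sum_const, Nat.card_Icc, nsmul_eq_mul, h2]
        have h : (t : ℝ) / 2 ≤ ((t + 1 - (t / 2 + 1) : ℕ) : ℝ) := by
          rw [div_le_iff₀ (by norm_num)]
          exact_mod_cast (by omega : t ≤ (t + 1 - (t / 2 + 1)) * 2)
        have := mul_le_mul_of_nonneg_right h (show 0 ≤ (1 / 2 : ℝ) ^ p by positivity)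
        linarith
    _ ≤ ∑ τ ∈ Finset.Icc (t / 2 + 1) t, ((τ : ℝ) / t) ^ p := by
        refine Finset.sum_le_sum fun τ hτ => ?_
        rw [Finset.mem_Icc] at hτ
        refine Real.rpow_le_rpow (by norm_num) ?_ hp.le
        have ht : (0 : ℝ) < t := by exact_mod_cast (by omega : 0 < t)
        rw [div_le_div_iff₀ (by norm_num) ht]
        exact_mod_cast (by omega : 1 * t ≤ τ * 2)
    _ ≤ weightSum p t :=
        Finset.sum_le_sum_of_subset_of_nonneg hsub fun τ _ _ => weight_nonneg p τ t

lemma weightSum_pos {p : ℝ} (hp : 0 < p) {t : ℕ} (ht : 1 ≤ t) : 0 < weightSum p t := by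
  have ht' : (0 : ℝ) < t := by exact_mod_cast ht
  exact lt_of_lt_of_le (by positivity) (weightSum_ge hp t)

section wavg

variable {E : Type*} [AddCommGroup E] [Module ℝ E]

lemma wavg_const {p : ℝ} (hp : 0 < p) {t : ℕ} (ht : 1 ≤ t) (c : E) :
    wavg p t (fun _ => c) = c := by
  unfold wavg
  rw [← Finset.sum_smul, smul_smul]
  change (1 / weightSum p t * weightSum p t) • c = c
  rw [one_div, inv_mul_cancel₀ (weightSum_pos hp ht).ne', one_smul]

lemma wavg_sub (p : ℝ) (t : ℕ) (a b : ℕ → E) :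
    wavg p t (fun τ => a τ - b τ) = wavg p t a - wavg p t b := by
  simp [wavg, smul_sub, Finset.sum_sub_distrib]

lemma map_wavg {E' : Type*} [AddCommGroup E'] [Module ℝ E'] (f : E →ₗ[ℝ] E') (p : ℝ) (t : ℕ)
    (a : ℕ → E) : f (wavg p t a) = wavg p t (fun τ => f (a τ)) := by
  simp [wavg]

/-- The weights of the first `t` terms are multiplied by the forgetting factor when the next
term arrives. -/
lemma forget_mul_weight {p : ℝ} {t : ℕ} (ht : 1 ≤ t) (τ : ℕ) :
    forget p (t + 1) * ((τ : ℝ) / (t : ℝ)) ^ p = ((τ : ℝ) / ((t + 1 : ℕ) : ℝ)) ^ p := by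
  have ht' : (0 : ℝ) < t := by exact_mod_cast ht
  have h1 : (1 : ℝ) - 1 / ((t + 1 : ℕ) : ℝ) = t / ((t + 1 : ℕ) : ℝ) := by
    push_cast; field_simp; ring
  rw [forget, h1, ← Real.mul_rpow (by positivity) (by positivity)]
  congr 1
  push_cast
  field_simp

lemma weighted_sum_succ {p : ℝ} (t : ℕ) (a : ℕ → E) :
    ∑ τ ∈ Finset.Icc 1 (t + 1), ((τ : ℝ) / ((t + 1 : ℕ) : ℝ)) ^ p • a τ =
      forget p (t + 1) • ∑ τ ∈ Finset.Icc 1 t, ((τ : ℝ) / (t : ℝ)) ^ p • a τ + a (t + 1) := by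
  rw [Finset.sum_Icc_succ_top (by omega), div_self (by positivity), Real.one_rpow, one_smul,
    Finset.smul_sum]
  congr 1
  refine Finset.sum_congr rfl fun τ hτ => ?_
  rw [Finset.mem_Icc] at hτ
  rw [smul_smul, forget_mul_weight (by omega)]

lemma weightSum_succ (p : ℝ) (t : ℕ) :
    weightSum p (t + 1) = forget p (t + 1) * weightSum p t + 1 := by
  have := weighted_sum_succ (p := p) t (fun _ => (1 : ℝ))
  simpa [weightSum] using this

lemma wavg_succ {p : ℝ} (hp : 0 < p) {t : ℕ} (ht : 1 ≤ t) (a : ℕ → E) :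
    wavg p (t + 1) a =
      wavg p t a + (1 / weightSum p (t + 1)) • (a (t + 1) - wavg p t a) := by
  have h0 := weightSum_pos hp ht
  have h1 := weightSum_pos hp (Nat.le_add_left 1 t)
  have h2 := weightSum_succ p t
  unfold wavg
  rw [weighted_sum_succ]
  set S := ∑ τ ∈ Finset.Icc 1 t, ((τ : ℝ) / (t : ℝ)) ^ p • a τ
  rw [smul_add, smul_sub, smul_smul, smul_smul, sub_eq_add_neg, ← add_assoc,
    add_right_comm, ← neg_smul, ← add_smul]
  congr 2
  field_simp
  linarith

end wavg

lemma wavg_mono {p : ℝ} (hp : 0 < p) {t : ℕ} {a b : ℕ → ℝ}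
    (h : ∀ τ, 1 ≤ τ → τ ≤ t → a τ ≤ b τ) : wavg p t a ≤ wavg p t b := by
  unfold wavg
  rcases Nat.eq_zero_or_pos t with rfl | ht
  · simp
  have := weightSum_pos hp ht
  refine smul_le_smul_of_nonneg_left (Finset.sum_le_sum fun τ hτ => ?_) (by positivity)
  rw [Finset.mem_Icc] at hτ
  exact smul_le_smul_of_nonneg_left (h τ hτ.1 hτ.2) (weight_nonneg p τ t)

lemma wavg_nonneg {p : ℝ} (hp : 0 < p) {t : ℕ} {a : ℕ → ℝ}
    (h : ∀ τ, 1 ≤ τ → τ ≤ t → 0 ≤ a τ) : 0 ≤ wavg p t a := by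
  have := wavg_mono hp (t := t) (a := fun _ => 0) h
  simpa [wavg] using this

section norm

variable {E : Type*} [NormedAddCommGroup E] [NormedSpace ℝ E]

lemma norm_wavg_le {p : ℝ} (hp : 0 < p) {t : ℕ} (ht : 1 ≤ t) {a : ℕ → E} {K : ℝ}
    (h : ∀ τ, 1 ≤ τ → τ ≤ t → ‖a τ‖ ≤ K) : ‖wavg p t a‖ ≤ K := by
  have hw := weightSum_pos hp ht
  rw [wavg, norm_smul, Real.norm_of_nonneg (by positivity), one_div, inv_mul_le_iff₀ hw]
  calc _ ≤ ∑ τ ∈ Finset.Icc 1 t, ((τ : ℝ) / (t : ℝ)) ^ p * K := by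
        refine norm_sum_le_of_le _ fun τ hτ => ?_
        rw [Finset.mem_Icc] at hτ
        rw [norm_smul, Real.norm_of_nonneg (weight_nonneg p τ t)]
        exact mul_le_mul_of_nonneg_left (h τ hτ.1 hτ.2) (weight_nonneg p τ t)
    _ = _ := by rw [← Finset.sum_mul]; rfl

lemma norm_wavg_succ_sub_le {p : ℝ} (hp : 0 < p) {t : ℕ} (ht : 1 ≤ t) {a : ℕ → E} {K : ℝ}
    (h : ∀ τ, 1 ≤ τ → ‖a τ‖ ≤ K) :
    ‖wavg p (t + 1) a - wavg p t a‖ ≤ 2 * K * 2 ^ (p + 1) / ((t + 1 : ℕ) : ℝ) := by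
  have hK : 0 ≤ K := (norm_nonneg _).trans (h 1 le_rfl)
  have hw := weightSum_pos hp (Nat.le_add_left 1 t)
  have hge := weightSum_ge hp (t + 1)
  rw [Real.rpow_neg (by norm_num), inv_mul_le_iff₀ (by positivity)] at hge
  rw [wavg_succ hp ht, add_sub_cancel_left, norm_smul, Real.norm_of_nonneg (by positivity)]
  have h1 : ‖a (t + 1) - wavg p t a‖ ≤ 2 * K := by
    refine (norm_sub_le _ _).trans ?_
    have := h (t + 1) (by omega)
    have := norm_wavg_le hp ht (a := a) fun τ h1 _ => h τ h1
    linarith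
  calc 1 / weightSum p (t + 1) * ‖a (t + 1) - wavg p t a‖
      ≤ 1 / weightSum p (t + 1) * (2 * K) := by gcongr
    _ ≤ (2 ^ (p + 1) / ((t + 1 : ℕ) : ℝ)) * (2 * K) := by
        refine mul_le_mul_of_nonneg_right ?_ (by positivity)
        rw [div_le_div_iff₀ hw (by positivity)]
        linarith
    _ = _ := by ring

end norm

/-! ### Polynomially growing blocks of time -/

lemma one_le_blockStart (a k : ℕ) : 1 ≤ (k + 1) ^ a := Nat.one_le_pow _ _ (by omega)

/-- Between `(k + 1) ^ a` and `(k + 2) ^ a` time grows by the factor `1 + O(1 / k)`. -/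
lemma blockLength_le (a k : ℕ) :
    (((k + 2) ^ a : ℕ) : ℝ) - ((k + 1) ^ a : ℕ) ≤ a / ((k : ℝ) + 2) * ((k + 2) ^ a : ℕ) := by
  have h : 1 + (a : ℝ) * (-1 / ((k : ℝ) + 2)) ≤ (1 + -1 / ((k : ℝ) + 2)) ^ a := by
    refine one_add_mul_le_pow ?_ a
    rw [le_div_iff₀ (by positivity)]
    have : (0 : ℝ) ≤ k := Nat.cast_nonneg k
    linarith
  have h2 : (1 : ℝ) + -1 / ((k : ℝ) + 2) = ((k : ℝ) + 1) / (k + 2) := by field_simp; ring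
  rw [h2, div_pow, le_div_iff₀ (by positivity)] at h
  push_cast
  have e : (1 + (a : ℝ) * (-1 / ((k : ℝ) + 2))) * ((k : ℝ) + 2) ^ a
    = ((k : ℝ) + 2) ^ a - a / ((k : ℝ) + 2) * ((k : ℝ) + 2) ^ a := by ring
  rw [e] at h
  linarith

lemma blockEnd_le (a k : ℕ) : (((k + 2) ^ a : ℕ) : ℝ) ≤ 2 ^ a * ((k + 1) ^ a : ℕ) := by
  push_cast
  rw [← mul_pow]
  refine pow_le_pow_left₀ (by positivity) ?_ a
  have : (0 : ℝ) ≤ k := Nat.cast_nonneg k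
  linarith

/-- A sequence with increments `O(1 / t)` drifts by `O(1 / k)` over the `k`-th block. -/
lemma dist_block_le {E : Type*} [PseudoMetricSpace E] {z : ℕ → E} {K : ℝ} (hK : 0 ≤ K)
    (hz : ∀ t, 1 ≤ t → dist (z t) (z (t + 1)) ≤ K / ((t + 1 : ℕ) : ℝ)) (a k : ℕ)
    {t : ℕ} (h1 : (k + 1) ^ a ≤ t) (h2 : t ≤ (k + 2) ^ a) :
    dist (z ((k + 1) ^ a)) (z t) ≤ K * (2 ^ a * a) / ((k : ℝ) + 1) := by
  set T := (k + 1) ^ a with hT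
  have hT1 : 1 ≤ T := one_le_blockStart a k
  have hTpos : (0 : ℝ) < T := by exact_mod_cast hT1
  calc dist (z T) (z t) ≤ ∑ i ∈ Finset.Ico T t, K / (T : ℝ) := by
        refine dist_le_Ico_sum_of_dist_le h1 fun {i} hi _ => (hz i (hT1.trans hi)).trans ?_
        refine div_le_div_of_nonneg_left hK hTpos ?_
        exact_mod_cast (by omega : T ≤ i + 1)
    _ = ((t : ℝ) - T) * (K / T) := by
        rw [Finset.sum_const, Nat.card_Ico, nsmul_eq_mul, Nat.cast_sub h1]
    _ ≤ (a / ((k : ℝ) + 2) * (2 ^ a * T)) * (K / T) := by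
        refine mul_le_mul_of_nonneg_right ?_ (by positivity)
        have h3 : (t : ℝ) ≤ ((k + 2) ^ a : ℕ) := by exact_mod_cast h2
        have h4 := blockLength_le a k
        have h5 := mul_le_mul_of_nonneg_left (blockEnd_le a k)
          (show 0 ≤ a / ((k : ℝ) + 2) by positivity)
        linarith
    _ = K * (2 ^ a * a) / ((k : ℝ) + 2) := by field_simp
    _ ≤ _ := by
        refine div_le_div_of_nonneg_left (by positivity) (by positivity) (by linarith)

lemma exists_block {a : ℕ} (ha : 1 ≤ a) {t : ℕ} (ht : 1 ≤ t) :
    ∃ k, (k + 1) ^ a ≤ t ∧ t ≤ (k + 2) ^ a := by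
  have hex : ∃ n, t < (n + 1) ^ a :=
    ⟨t, (Nat.lt_succ_self t).trans_le (Nat.le_self_pow (by omega) _)⟩
  have h0 : Nat.find hex ≠ 0 := by
    intro h
    have := Nat.find_spec hex
    rw [h] at this
    simp at this
    omega
  obtain ⟨k, hk⟩ := Nat.exists_eq_succ_of_ne_zero h0
  refine ⟨k, ?_, ?_⟩
  · exact not_lt.1 (Nat.find_min hex (by omega : k < Nat.find hex))
  · have := Nat.find_spec hex
    rw [hk] at this
    exact this.le

/-- A real sequence with increments `O(1 / t)` converges as soon as it does along the block
starts. -/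
lemma tendsto_of_tendsto_blocks {z : ℕ → ℝ} {K l : ℝ}
    (hz : ∀ t, 1 ≤ t → |z (t + 1) - z t| ≤ K / ((t + 1 : ℕ) : ℝ)) {a : ℕ} (ha : 1 ≤ a)
    (hl : Tendsto (fun k : ℕ => z ((k + 1) ^ a)) atTop (𝓝 l)) : Tendsto z atTop (𝓝 l) := by
  have hK : 0 ≤ K := by
    have h := (abs_nonneg _).trans (hz 1 le_rfl)
    have h2 : (0 : ℝ) < ((1 + 1 : ℕ) : ℝ) := by norm_num
    rwa [le_div_iff₀ h2, zero_mul] at h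
  have hd : ∀ t, 1 ≤ t → dist (z t) (z (t + 1)) ≤ K / ((t + 1 : ℕ) : ℝ) := fun t ht => by
    rw [dist_comm, Real.dist_eq]; exact hz t ht
  have hlim : Tendsto (fun k : ℕ => K * (2 ^ a * a) / ((k : ℝ) + 1)) atTop (𝓝 0) := by
    simpa [div_eq_mul_inv] using
      tendsto_one_div_add_atTop_nhds_zero_nat.const_mul (K * (2 ^ a * (a : ℝ)))
  rw [Metric.tendsto_atTop] at hl ⊢
  intro ε hε
  obtain ⟨k1, hk1⟩ := hl (ε / 2) (by positivity)
  obtain ⟨k2, hk2⟩ := eventually_atTop.1 (hlim.eventually_lt_const (show 0 < ε / 2 by positivity))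
  refine ⟨(max k1 k2 + 2) ^ a + 1, fun t ht => ?_⟩
  obtain ⟨k, hk⟩ := exists_block ha (show 1 ≤ t by omega)
  have hkk : max k1 k2 ≤ k := by
    by_contra! hlt
    have : (k + 2) ^ a ≤ (max k1 k2 + 2) ^ a := Nat.pow_le_pow_left (by omega) a
    omega
  have h1 := hk1 k (le_trans (le_max_left _ _) hkk)
  have h2 := hk2 k (le_trans (le_max_right _ _) hkk)
  have h3 := dist_block_le hK hd a k hk.1 hk.2
  have h4 := dist_triangle_left (z t) l (z ((k + 1) ^ a))
  linarith

/-- Over a block the weighted mean of a sequence that is at most `m` on the block contracts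
towards `m`, at the rate of the proportion `w ≍ 1 / k` of the weight that is new. -/
lemma wavg_block_le {p : ℝ} (hp : 0 < p) (a : ℕ) (ha : 1 ≤ a) (k : ℕ) {c : ℕ → ℝ} {m : ℝ}
    (hm : 0 ≤ m) (hc : ∀ τ, 1 ≤ τ → 0 ≤ c τ)
    (hcm : ∀ τ, (k + 1) ^ a < τ → τ ≤ (k + 2) ^ a → c τ ≤ m) :
    wavg p ((k + 2) ^ a) c ≤ wavg p ((k + 1) ^ a) c
      - (1 / 2 ^ a) ^ p / ((k : ℝ) + 2) * wavg p ((k + 1) ^ a) c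
      + a * 2 ^ (p + 1) / ((k : ℝ) + 2) * m := by
  set T := (k + 1) ^ a with hT
  set T' := (k + 2) ^ a with hT'
  have hT1 : 1 ≤ T := one_le_blockStart a k
  have hT'1 : 1 ≤ T' := Nat.one_le_pow _ _ (by omega)
  have hTT : T ≤ T' := Nat.pow_le_pow_left (by omega) a
  have hTpos : (0 : ℝ) < T := by exact_mod_cast hT1
  have hT'pos : (0 : ℝ) < T' := by exact_mod_cast hT'1
  -- the weight of the old terms, relative to the new time
  set r : ℝ := ((T : ℝ) / T') ^ p with hr
  have hr0 : 0 ≤ r := by positivity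
  have hsplit : ∀ b : ℕ → ℝ, ∑ τ ∈ Finset.Icc 1 T', ((τ : ℝ) / T') ^ p * b τ
      = r * ∑ τ ∈ Finset.Icc 1 T, ((τ : ℝ) / T) ^ p * b τ
        + ∑ τ ∈ Finset.Ioc T T', ((τ : ℝ) / T') ^ p * b τ := by
    intro b
    have hu : Finset.Icc 1 T' = Finset.Icc 1 T ∪ Finset.Ioc T T' := by
      ext τ; simp only [Finset.mem_Icc, Finset.mem_union, Finset.mem_Ioc]; omega
    rw [hu, Finset.sum_union, Finset.mul_sum]
    · congr 1
      refine Finset.sum_congr rfl fun τ _ => ?_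
      rw [← mul_assoc, hr, ← Real.mul_rpow (by positivity) (by positivity)]
      congr 2
      field_simp
    · rw [Finset.disjoint_left]
      intro τ h1 h2
      simp only [Finset.mem_Icc, Finset.mem_Ioc] at h1 h2
      omega
  set N := ∑ τ ∈ Finset.Ioc T T', ((τ : ℝ) / T') ^ p with hN
  have hW : weightSum p T' = r * weightSum p T + N := by
    simpa [weightSum] using hsplit fun _ => 1
  have hΛ := weightSum_pos hp hT1
  have hΛ' := weightSum_pos hp hT'1
  have hcard : ((Finset.Ioc T T').card : ℝ) = (T' : ℝ) - T := by
    rw [Nat.card_Ioc, Nat.cast_sub hTT]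
  have hNle : N ≤ (T' : ℝ) - T := by
    rw [← hcard, ← nsmul_one, ← Finset.sum_const]
    refine Finset.sum_le_sum fun τ hτ => ?_
    rw [Finset.mem_Ioc] at hτ
    refine Real.rpow_le_one (by positivity) ?_ hp.le
    rw [div_le_one hT'pos]
    exact_mod_cast hτ.2
  have hNge : ((T' : ℝ) - T) * (1 / 2 ^ a) ^ p ≤ N := by
    rw [← hcard, ← nsmul_eq_mul, ← Finset.sum_const]
    refine Finset.sum_le_sum fun τ hτ => ?_
    rw [Finset.mem_Ioc] at hτ
    refine Real.rpow_le_rpow (by positivity) ?_ hp.le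
    rw [div_le_div_iff₀ (by positivity) hT'pos, one_mul]
    refine (blockEnd_le a k).trans ?_
    rw [mul_comm]
    refine mul_le_mul_of_nonneg_right ?_ (by positivity)
    exact_mod_cast hτ.1.le
  have hΛle : weightSum p T' ≤ T' := by
    have : ∑ τ ∈ Finset.Icc 1 T', ((τ : ℝ) / T') ^ p ≤ ∑ τ ∈ Finset.Icc 1 T', (1 : ℝ) := by
      refine Finset.sum_le_sum fun τ hτ => ?_
      rw [Finset.mem_Icc] at hτ
      refine Real.rpow_le_one (by positivity) ?_ hp.le
      rw [div_le_one hT'pos]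
      exact_mod_cast hτ.2
    simpa [weightSum] using this
  have hΛge := weightSum_ge hp T'
  rw [Real.rpow_neg (by norm_num), inv_mul_le_iff₀ (by positivity)] at hΛge
  have hlen_ge : (T' : ℝ) / ((k : ℝ) + 2) ≤ (T' : ℝ) - T := by
    have h1 : (T : ℝ) ≤ (T' : ℝ) * (((k : ℝ) + 1) / (k + 2)) := by
      rw [hT, hT']
      push_cast
      obtain ⟨b, rfl⟩ := Nat.exists_eq_add_of_le' ha
      rw [pow_succ, pow_succ]
      have : ((k : ℝ) + 1) ^ b ≤ ((k : ℝ) + 2) ^ b :=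
        pow_le_pow_left₀ (by positivity) (by linarith) b
      calc ((k : ℝ) + 1) ^ b * (k + 1) ≤ ((k : ℝ) + 2) ^ b * (k + 1) := by gcongr
        _ = _ := by field_simp
    have h2 : (T' : ℝ) * (((k : ℝ) + 1) / (k + 2)) = T' - T' / ((k : ℝ) + 2) := by
      field_simp; ring
    linarith
  have hcT : 0 ≤ wavg p T c := wavg_nonneg hp fun τ h _ => hc τ h
  have hnew : ∑ τ ∈ Finset.Ioc T T', ((τ : ℝ) / T') ^ p * c τ ≤ N * m := by
    rw [hN, Finset.sum_mul]
    refine Finset.sum_le_sum fun τ hτ => ?_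
    rw [Finset.mem_Ioc] at hτ
    exact mul_le_mul_of_nonneg_left (hcm τ hτ.1 hτ.2) (by positivity)
  have hold : ∑ τ ∈ Finset.Icc 1 T, ((τ : ℝ) / T) ^ p * c τ = weightSum p T * wavg p T c := by
    simp only [wavg, smul_eq_mul]
    field_simp
  have h1 : weightSum p T' * wavg p T' c ≤ (weightSum p T' - N) * wavg p T c + N * m := by
    have e : weightSum p T' * wavg p T' c = ∑ τ ∈ Finset.Icc 1 T', ((τ : ℝ) / T') ^ p * c τ := by
      simp only [wavg, smul_eq_mul]
      field_simp
    rw [e, hsplit, hold, hW]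
    linarith
  have h2 : (1 / 2 ^ a) ^ p / ((k : ℝ) + 2) * weightSum p T' ≤ N := by
    calc (1 / 2 ^ a) ^ p / ((k : ℝ) + 2) * weightSum p T'
        ≤ (1 / 2 ^ a) ^ p / ((k : ℝ) + 2) * T' := by gcongr
      _ = (T' : ℝ) / ((k : ℝ) + 2) * (1 / 2 ^ a) ^ p := by ring
      _ ≤ ((T' : ℝ) - T) * (1 / 2 ^ a) ^ p := by gcongr
      _ ≤ N := hNge
  have h3 : N ≤ a * 2 ^ (p + 1) / ((k : ℝ) + 2) * weightSum p T' := by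
    calc N ≤ (T' : ℝ) - T := hNle
      _ ≤ a / ((k : ℝ) + 2) * T' := blockLength_le a k
      _ ≤ a / ((k : ℝ) + 2) * (2 ^ (p + 1) * weightSum p T') := by gcongr
      _ = _ := by ring
  refine le_of_mul_le_mul_left ?_ hΛ'
  have h4 := mul_le_mul_of_nonneg_right h2 hcT
  have h5 := mul_le_mul_of_nonneg_right h3 hm
  nlinarith

/-! ### Real sequences with summable perturbations -/

/-- If a nonnegative sequence changes by `O(1 / k)` in each step and is summable against
`1 / k`, then it tends to zero: its square has summable increments, hence a limit, which the
divergence of the harmonic series forces to vanish. -/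
lemma tendsto_zero_of_summable_div {h : ℕ → ℝ} (h0 : ∀ k, 0 ≤ h k) {K : ℝ}
    (hK : ∀ k : ℕ, |h (k + 1) - h k| ≤ K / ((k : ℝ) + 2))
    (hs : Summable fun k : ℕ => h k / ((k : ℝ) + 2)) : Tendsto h atTop (𝓝 0) := by
  have hK0 : 0 ≤ K := by
    have h1 := (abs_nonneg _).trans (hK 0)
    rwa [le_div_iff₀ (by positivity), zero_mul] at h1
  have hsq : Summable fun k : ℕ => 1 / ((k : ℝ) + 2) ^ 2 := by
    have := (summable_nat_add_iff (f := fun n : ℕ => 1 / (n : ℝ) ^ 2) 2).2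
      (Real.summable_one_div_nat_pow.2 (by norm_num))
    simpa using this
  have hinc : Summable fun k => h (k + 1) ^ 2 - h k ^ 2 := by
    refine Summable.of_norm_bounded
      (g := fun k : ℕ => 2 * K * (h k / ((k : ℝ) + 2)) + K ^ 2 * (1 / ((k : ℝ) + 2) ^ 2))
      ((hs.mul_left _).add (hsq.mul_left _)) fun k => ?_
    have h1 := hK k
    have h2 : h (k + 1) + h k ≤ 2 * h k + K / ((k : ℝ) + 2) := by
      have := (le_abs_self _).trans h1
      linarith
    calc ‖h (k + 1) ^ 2 - h k ^ 2‖ = (h (k + 1) + h k) * |h (k + 1) - h k| := by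
          rw [Real.norm_eq_abs, sq_sub_sq, abs_mul,
            abs_of_nonneg (add_nonneg (h0 _) (h0 _))]
      _ ≤ (2 * h k + K / ((k : ℝ) + 2)) * (K / ((k : ℝ) + 2)) := by
          have := h0 k
          gcongr
      _ = _ := by field_simp
  obtain ⟨S, hS⟩ := hinc
  have hlim : Tendsto (fun k => h k ^ 2) atTop (𝓝 (S + h 0 ^ 2)) := by
    have := (hS.tendsto_sum_nat).add_const (h 0 ^ 2)
    refine this.congr fun k => ?_
    rw [Finset.sum_range_sub (fun k => h k ^ 2)]
    ring
  set q := S + h 0 ^ 2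
  have hlim' : Tendsto h atTop (𝓝 (Real.sqrt q)) := by
    refine ((Real.continuous_sqrt.tendsto q).comp hlim).congr fun k => ?_
    simp [Real.sqrt_sq (h0 k)]
  rcases (Real.sqrt_nonneg q).eq_or_lt with hq | hq
  · rwa [← hq] at hlim'
  · exfalso
    obtain ⟨n, hn⟩ := eventually_atTop.1 (hlim'.eventually_const_lt (half_lt_self hq))
    have hharm : Summable fun k : ℕ => 1 / (((k + n : ℕ) : ℝ) + 2) := by
      refine Summable.of_nonneg_of_le (fun k => by positivity) (fun k => ?_)
        (((summable_nat_add_iff n).2 hs).mul_left (2 / Real.sqrt q))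
      have := hn (k + n) (by omega)
      rw [← mul_div_assoc]
      refine div_le_div_of_nonneg_right ?_ (by positivity)
      rw [div_mul_eq_mul_div, le_div_iff₀ hq]
      linarith
    have h3 : Summable fun k : ℕ => 1 / ((k : ℝ) + 2) :=
      (summable_nat_add_iff (f := fun k : ℕ => 1 / ((k : ℝ) + 2)) n).1 hharm
    have h4 : Summable fun k : ℕ => 1 / (k : ℝ) := by
      refine (summable_nat_add_iff 2).1 (h3.congr fun k => ?_)
      push_cast; rfl
    exact Real.not_summable_one_div_natCast h4

/-- A nonnegative sequence whose decrease is controlled by `h / k`, up to summable errors,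
converges, and `h` tends to zero if it moves by `O(1 / k)` in each step. -/
lemma tendsto_of_almost_decreasing {u h e : ℕ → ℝ} {c K : ℝ} (hc : 0 < c)
    (hu0 : ∀ k, 0 ≤ u k) (h0 : ∀ k, 0 ≤ h k) (he : Summable e)
    (hu : ∀ k : ℕ, u (k + 1) ≤ u k - c / ((k : ℝ) + 2) * h k + e k)
    (hK : ∀ k : ℕ, |h (k + 1) - h k| ≤ K / ((k : ℝ) + 2)) :
    (∃ l, Tendsto u atTop (𝓝 l)) ∧ Tendsto h atTop (𝓝 0) := by
  have hes : Tendsto (fun n => ∑ k ∈ Finset.range n, e k) atTop (𝓝 (∑' k, e k)) :=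
    he.hasSum.tendsto_sum_nat
  have hch : ∀ k : ℕ, 0 ≤ c / ((k : ℝ) + 2) * h k := fun k => by
    have := h0 k
    positivity
  constructor
  · set v : ℕ → ℝ := fun n => u n - ∑ k ∈ Finset.range n, e k with hv
    have hanti : Antitone v := antitone_nat_of_succ_le fun n => by
      simp only [hv, Finset.sum_range_succ]
      have := hu n
      have := hch n
      linarith
    obtain ⟨B, hB⟩ := hes.bddAbove_range
    have hbdd : BddBelow (Set.range v) := by
      refine ⟨-B, ?_⟩
      rintro _ ⟨n, rfl⟩
      have := hB ⟨n, rfl⟩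
      have := hu0 n
      simp only [hv] at *
      linarith
    refine ⟨_, ((tendsto_atTop_ciInf hanti hbdd).add hes).congr fun n => ?_⟩
    simp [hv]
  · refine tendsto_zero_of_summable_div h0 hK ?_
    obtain ⟨B, hB⟩ := hes.bddAbove_range
    have hsum : ∀ n, u n + ∑ k ∈ Finset.range n, c / ((k : ℝ) + 2) * h k
        ≤ u 0 + ∑ k ∈ Finset.range n, e k := by
      intro n
      induction n with
      | zero => simp
      | succ n ih =>
        rw [Finset.sum_range_succ, Finset.sum_range_succ]
        have := hu n
        linarith
    have hS : Summable fun k : ℕ => c / ((k : ℝ) + 2) * h k := by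
      refine summable_of_sum_range_le (c := u 0 + B) hch fun n => ?_
      have := hsum n
      have := hu0 n
      have := hB ⟨n, rfl⟩
      simp only at this
      linarith
    refine (hS.mul_left c⁻¹).congr fun k => ?_
    field_simp

/-! ### Convergence of inexact majorization–minimization with weighted surrogates -/

/-- The deterministic properties of a trajectory `d` in a set `C` of diameter at most `2 r` that
force its convergence. The `τ`-th sample has loss `φ τ`, majorized by the convex function `ℓ τ`
with gradient `g τ` and curvature at most `K`, with equality at the iterate at which the sample
was drawn. The iterate `d t` minimizes the weighted mean of the surrogates over `C` up to an error
`c / t` in the variational inequality, and these means are `μ`-strongly convex. -/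
structure SurrogateRun {E : Type*} [NormedAddCommGroup E] [InnerProductSpace ℝ E]
    (p K r c μ : ℝ) (C : Set E) (ℓ φ : ℕ → E → ℝ) (g : ℕ → E → E) (d : ℕ → E) : Prop where
  p_pos : 0 < p
  K_nonneg : 0 ≤ K
  c_nonneg : 0 ≤ c
  μ_pos : 0 < μ
  norm_le : ∀ e ∈ C, ‖e‖ ≤ r
  mem : ∀ t, d t ∈ C
  sample_nonneg : ∀ τ, 1 ≤ τ → ∀ e, 0 ≤ φ τ e
  sample_le : ∀ τ, 1 ≤ τ → ∀ e, φ τ e ≤ ℓ τ e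
  sample_eq : ∀ t, ℓ (t + 1) (d t) = φ (t + 1) (d t)
  sample_lip : ∀ τ, 1 ≤ τ → ∀ e e', ‖e‖ ≤ 3 * r → ‖e'‖ ≤ 3 * r →
    |φ τ e - φ τ e'| ≤ K * ‖e - e'‖
  surr_le : ∀ τ, 1 ≤ τ → ∀ e ∈ C, ℓ τ e ≤ K
  grad_le : ∀ τ, 1 ≤ τ → ∀ e ∈ C, ‖g τ e‖ ≤ K
  convex : ∀ τ, 1 ≤ τ → ∀ e e', ℓ τ e + ⟪g τ e, e' - e⟫ ≤ ℓ τ e'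
  smooth : ∀ τ, 1 ≤ τ → ∀ e e', ℓ τ e' ≤ ℓ τ e + ⟪g τ e, e' - e⟫ + K / 2 * ‖e' - e‖ ^ 2
  approx_min : ∀ t, 1 ≤ t → ∀ e ∈ C,
    -(c / t) * ‖e - d t‖ ≤ ⟪wavg p t (fun τ => g τ (d t)), e - d t⟫
  strong : ∀ t, 1 ≤ t → ∀ e e', μ * ‖e - e'‖ ^ 2 ≤
    ⟪wavg p t (fun τ => g τ e) - wavg p t (fun τ => g τ e'), e - e'⟫

lemma inner_wavg {E : Type*} [NormedAddCommGroup E] [InnerProductSpace ℝ E] (p : ℝ) (t : ℕ)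
    (a : ℕ → E) (v : E) : ⟪wavg p t a, v⟫ = wavg p t (fun τ => ⟪a τ, v⟫) := by
  rw [real_inner_comm]
  simp only [real_inner_comm v]
  exact map_wavg (innerₛₗ ℝ v) p t a

namespace SurrogateRun

variable {E : Type*} [NormedAddCommGroup E] [InnerProductSpace ℝ E]
  {p K r c μ : ℝ} {C : Set E} {ℓ φ : ℕ → E → ℝ} {g : ℕ → E → E} {d : ℕ → E}

lemma r_nonneg (H : SurrogateRun p K r c μ C ℓ φ g d) : 0 ≤ r :=
  (norm_nonneg _).trans (H.norm_le _ (H.mem 0))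

lemma norm_sub_le (H : SurrogateRun p K r c μ C ℓ φ g d) {e e' : E} (he : e ∈ C) (he' : e' ∈ C) :
    ‖e - e'‖ ≤ 2 * r := by
  have h1 := _root_.norm_sub_le e e'
  have h2 := H.norm_le _ he
  have h3 := H.norm_le _ he'
  linarith

lemma surr_lip (H : SurrogateRun p K r c μ C ℓ φ g d) {τ : ℕ} (hτ : 1 ≤ τ) {e e' : E}
    (he : e ∈ C) (he' : e' ∈ C) : |ℓ τ e - ℓ τ e'| ≤ K * ‖e - e'‖ := by
  have key : ∀ a ∈ C, ∀ b, ℓ τ a - ℓ τ b ≤ K * ‖a - b‖ := fun a ha b => by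
    have h1 := H.convex τ hτ a b
    have h2 := neg_le_of_abs_le (abs_real_inner_le_norm (g τ a) (b - a))
    have h3 := mul_le_mul_of_nonneg_right (H.grad_le τ hτ a ha) (norm_nonneg (b - a))
    rw [norm_sub_rev b a] at *
    linarith
  rw [abs_sub_le_iff]
  exact ⟨key e he e', norm_sub_rev e e' ▸ key e' he' e⟩

lemma sample_lip_on (H : SurrogateRun p K r c μ C ℓ φ g d) {τ : ℕ} (hτ : 1 ≤ τ) {e e' : E}
    (he : e ∈ C) (he' : e' ∈ C) : |φ τ e - φ τ e'| ≤ K * ‖e - e'‖ := by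
  have := H.r_nonneg
  exact H.sample_lip τ hτ e e' ((H.norm_le _ he).trans (by linarith))
    ((H.norm_le _ he').trans (by linarith))

/-- Successive minimizers are `O(1 / t)` apart, since the surrogates are strongly convex and their
gradients change by `O(1 / t)`. -/
lemma dist_succ_le (H : SurrogateRun p K r c μ C ℓ φ g d) {t : ℕ} (ht : 1 ≤ t) :
    ‖d t - d (t + 1)‖ ≤ (3 * c + 2 * K * 2 ^ (p + 1)) / μ / ((t + 1 : ℕ) : ℝ) := by
  have ht' : (1 : ℝ) ≤ t := by exact_mod_cast ht
  set Δ := ‖d t - d (t + 1)‖ with hΔ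
  have hΔ0 : 0 ≤ Δ := norm_nonneg _
  have h1 := H.strong (t + 1) (by omega) (d (t + 1)) (d t)
  have h2 := H.approx_min (t + 1) (by omega) (d t) (H.mem t)
  have h3 := H.approx_min t ht (d (t + 1)) (H.mem (t + 1))
  have h4 := norm_wavg_succ_sub_le H.p_pos ht (a := fun τ => g τ (d t)) (K := K)
    fun τ hτ => H.grad_le τ hτ _ (H.mem t)
  have h5 := abs_le.1 (abs_real_inner_le_norm
    (wavg p (t + 1) (fun τ => g τ (d t)) - wavg p t (fun τ => g τ (d t))) (d (t + 1) - d t))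
  have h6 := mul_le_mul_of_nonneg_right h4 (norm_nonneg (d (t + 1) - d t))
  rw [inner_sub_left] at h1 h5
  rw [norm_sub_rev (d (t + 1)) (d t)] at *
  have h7 : ⟪wavg p (t + 1) (fun τ => g τ (d (t + 1))), d t - d (t + 1)⟫
      = -⟪wavg p (t + 1) (fun τ => g τ (d (t + 1))), d (t + 1) - d t⟫ := by
    rw [← inner_neg_right, neg_sub]
  rw [h7] at h2
  rw [← hΔ] at *
  have h8 : c / t ≤ 2 * c / ((t + 1 : ℕ) : ℝ) := by
    rw [div_le_div_iff₀ (by positivity) (by positivity)]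
    have := H.c_nonneg
    push_cast
    nlinarith
  have h9 := mul_le_mul_of_nonneg_right h8 hΔ0
  have h10 : μ * Δ ^ 2 ≤ (3 * c + 2 * K * 2 ^ (p + 1)) / ((t + 1 : ℕ) : ℝ) * Δ := by
    have : (3 * c + 2 * K * 2 ^ (p + 1)) / ((t + 1 : ℕ) : ℝ) * Δ = c / ((t + 1 : ℕ) : ℝ) * Δ
      + 2 * c / ((t + 1 : ℕ) : ℝ) * Δ + 2 * K * 2 ^ (p + 1) / ((t + 1 : ℕ) : ℝ) * Δ := by
      ring
    linarith [h5.1]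
  have := H.K_nonneg
  have := H.c_nonneg
  have := H.μ_pos
  rcases hΔ0.eq_or_lt with h0 | h0
  · rw [← h0]; positivity
  · rw [div_right_comm, le_div_iff₀ H.μ_pos]
    refine le_of_mul_le_mul_right ?_ h0
    linarith

/-- The weighted mean of bounded Lipschitz functions, evaluated along the trajectory, has
increments `O(1 / t)`. -/
lemma abs_wavg_along_succ_sub_le (H : SurrogateRun p K r c μ C ℓ φ g d) {f : ℕ → E → ℝ}
    (hb : ∀ τ, 1 ≤ τ → ∀ e ∈ C, |f τ e| ≤ K)
    (hf : ∀ τ, 1 ≤ τ → ∀ e ∈ C, ∀ e' ∈ C, |f τ e - f τ e'| ≤ K * ‖e - e'‖) {t : ℕ} (ht : 1 ≤ t) :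
    |wavg p (t + 1) (fun τ => f τ (d (t + 1))) - wavg p t (fun τ => f τ (d t))| ≤
      (K * ((3 * c + 2 * K * 2 ^ (p + 1)) / μ) + 2 * K * 2 ^ (p + 1)) / ((t + 1 : ℕ) : ℝ) := by
  have h1 := norm_wavg_succ_sub_le H.p_pos ht (a := fun τ => f τ (d t)) (K := K)
    fun τ hτ => hb τ hτ _ (H.mem t)
  have h2 : ‖wavg p (t + 1) (fun τ => f τ (d (t + 1)) - f τ (d t))‖
      ≤ K * ((3 * c + 2 * K * 2 ^ (p + 1)) / μ / ((t + 1 : ℕ) : ℝ)) := by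
    refine norm_wavg_le H.p_pos (by omega) fun τ hτ _ => ?_
    refine (hf τ hτ _ (H.mem _) _ (H.mem _)).trans ?_
    rw [norm_sub_rev]
    exact mul_le_mul_of_nonneg_left (H.dist_succ_le ht) H.K_nonneg
  rw [wavg_sub] at h2
  rw [Real.norm_eq_abs] at h1 h2
  have h3 := abs_sub_le (wavg p (t + 1) (fun τ => f τ (d (t + 1))))
    (wavg p (t + 1) (fun τ => f τ (d t))) (wavg p t (fun τ => f τ (d t)))
  have h4 : (K * ((3 * c + 2 * K * 2 ^ (p + 1)) / μ) + 2 * K * 2 ^ (p + 1)) / ((t + 1 : ℕ) : ℝ)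
    = K * ((3 * c + 2 * K * 2 ^ (p + 1)) / μ / ((t + 1 : ℕ) : ℝ))
      + 2 * K * 2 ^ (p + 1) / ((t + 1 : ℕ) : ℝ) := by ring
  linarith

lemma abs_surr_le (H : SurrogateRun p K r c μ C ℓ φ g d) (τ : ℕ) (hτ : 1 ≤ τ) (e : E)
    (he : e ∈ C) : |ℓ τ e| ≤ K := by
  rw [abs_of_nonneg ((H.sample_nonneg τ hτ e).trans (H.sample_le τ hτ e))]
  exact H.surr_le τ hτ e he

lemma abs_sample_le (H : SurrogateRun p K r c μ C ℓ φ g d) (τ : ℕ) (hτ : 1 ≤ τ) (e : E)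
    (he : e ∈ C) : |φ τ e| ≤ K := by
  rw [abs_of_nonneg (H.sample_nonneg τ hτ e)]
  exact (H.sample_le τ hτ e).trans (H.surr_le τ hτ e he)

/-- Convexity and the approximate variational inequality bound the optimality gap. -/
lemma surr_along_le (H : SurrogateRun p K r c μ C ℓ φ g d) {t : ℕ} (ht : 1 ≤ t) {e : E}
    (he : e ∈ C) :
    wavg p t (fun τ => ℓ τ (d t)) ≤ wavg p t (fun τ => ℓ τ e) + 2 * r * c / t := by
  have h1 : wavg p t (fun τ => ⟪g τ (d t), e - d t⟫)
      ≤ wavg p t (fun τ => ℓ τ e - ℓ τ (d t)) :=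
    wavg_mono H.p_pos fun τ hτ _ => by linarith [H.convex τ hτ (d t) e]
  rw [wavg_sub, ← inner_wavg] at h1
  have h2 := H.approx_min t ht e he
  have h3 : c / t * ‖e - d t‖ ≤ c / t * (2 * r) :=
    mul_le_mul_of_nonneg_left (H.norm_sub_le he (H.mem t))
      (div_nonneg H.c_nonneg (Nat.cast_nonneg t))
  have h4 : 2 * r * c / t = c / t * (2 * r) := by ring
  linarith

lemma abs_wavg_sample_sub_le (H : SurrogateRun p K r c μ C ℓ φ g d) {t : ℕ} (ht : 1 ≤ t) {e e' : E}
    (he : ‖e‖ ≤ 3 * r) (he' : ‖e'‖ ≤ 3 * r) :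
    |wavg p t (fun τ => φ τ e) - wavg p t (fun τ => φ τ e')| ≤ K * ‖e - e'‖ := by
  rw [← wavg_sub, ← Real.norm_eq_abs]
  exact norm_wavg_le H.p_pos ht fun τ hτ _ => H.sample_lip τ hτ e e' he he'

variable {F : E → ℝ} {a : ℕ} {ε : ℕ → ℝ}

/-- The limit of the weighted means of the sample losses inherits their Lipschitz constant. -/
lemma limit_lip (H : SurrogateRun p K r c μ C ℓ φ g d) (hε : Summable ε)
    (hF : ∀ k e, ‖e‖ ≤ 3 * r → |wavg p ((k + 1) ^ a) (fun τ => φ τ e) - F e| ≤ ε k)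
    {e e' : E} (he : ‖e‖ ≤ 3 * r) (he' : ‖e'‖ ≤ 3 * r) : |F e - F e'| ≤ K * ‖e - e'‖ := by
  have hlim : ∀ e, ‖e‖ ≤ 3 * r →
      Tendsto (fun k : ℕ => wavg p ((k + 1) ^ a) (fun τ => φ τ e)) atTop (𝓝 (F e)) := fun e he => by
    rw [tendsto_iff_dist_tendsto_zero]
    exact squeeze_zero (fun _ => dist_nonneg) (fun k => hF k e he) hε.tendsto_atTop_zero
  exact le_of_tendsto ((hlim e he).sub (hlim e' he')).abs
    (Eventually.of_forall fun k => H.abs_wavg_sample_sub_le (one_le_blockStart a k) he he')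

lemma norm_le_three (H : SurrogateRun p K r c μ C ℓ φ g d) {e : E} (he : e ∈ C) :
    ‖e‖ ≤ 3 * r := by
  have := H.r_nonneg
  exact (H.norm_le _ he).trans (by linarith)

/-- The surrogate values converge, and the surrogates become tight along the trajectory. Over the
`k`-th block of time the surrogate value decreases by a multiple of `1 / k` times the tightness
gap, up to the change of the empirical sample loss at a fixed point (summable by the uniform
law of large numbers) and a drift of order `1 / k²`. -/
lemma tendsto_surr_along (H : SurrogateRun p K r c μ C ℓ φ g d) (ha : 2 ≤ a) (hε : Summable ε)
    (hF : ∀ k e, ‖e‖ ≤ 3 * r → |wavg p ((k + 1) ^ a) (fun τ => φ τ e) - F e| ≤ ε k) :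
    (∃ l, Tendsto (fun t => wavg p t (fun τ => ℓ τ (d t))) atTop (𝓝 l)) ∧
      Tendsto (fun t => wavg p t (fun τ => ℓ τ (d t)) - F (d t)) atTop (𝓝 0) := by
  have hK := H.K_nonneg
  have hc := H.c_nonneg
  have hμ := H.μ_pos
  have hr := H.r_nonneg
  have hp := H.p_pos
  set D := (3 * c + 2 * K * 2 ^ (p + 1)) / μ with hD
  have hD0 : 0 ≤ D := by positivity
  set K' := K * D + 2 * K * 2 ^ (p + 1) with hK'
  have hK'0 : 0 ≤ K' := by positivity
  set u : ℕ → ℝ := fun t => wavg p t (fun τ => ℓ τ (d t)) with hu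
  set f : ℕ → ℝ := fun t => wavg p t (fun τ => φ τ (d t)) with hf
  have hu1 : ∀ t, 1 ≤ t → |u (t + 1) - u t| ≤ K' / ((t + 1 : ℕ) : ℝ) := fun t ht =>
    H.abs_wavg_along_succ_sub_le H.abs_surr_le
      (fun τ hτ e he e' he' => H.surr_lip hτ he he') ht
  have hf1 : ∀ t, 1 ≤ t → |f (t + 1) - f t| ≤ K' / ((t + 1 : ℕ) : ℝ) := fun t ht =>
    H.abs_wavg_along_succ_sub_le H.abs_sample_le
      (fun τ hτ e he e' he' => H.sample_lip_on hτ he he') ht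
  have hblock : ∀ (z : ℕ → ℝ), (∀ t, 1 ≤ t → |z (t + 1) - z t| ≤ K' / ((t + 1 : ℕ) : ℝ)) →
      ∀ k : ℕ, |z ((k + 2) ^ a) - z ((k + 1) ^ a)| ≤ K' * (2 ^ a * a) / ((k : ℝ) + 1) := by
    intro z hz k
    have := dist_block_le hK'0 (z := z) (fun t ht => by
      rw [dist_comm, Real.dist_eq]; exact hz t ht) a k
      (Nat.pow_le_pow_left (by omega) a) le_rfl
    rwa [dist_comm, Real.dist_eq] at this
  have hdist : ∀ k t, (k + 1) ^ a ≤ t → t ≤ (k + 2) ^ a →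
      ‖d ((k + 1) ^ a) - d t‖ ≤ D * (2 ^ a * a) / ((k : ℝ) + 1) := fun k t h1 h2 => by
    rw [← dist_eq_norm]
    exact dist_block_le hD0 (fun t ht => by rw [dist_eq_norm]; exact H.dist_succ_le ht) a k h1 h2
  set h : ℕ → ℝ := fun k => u ((k + 1) ^ a) - f ((k + 1) ^ a) with hh
  have hh0 : ∀ k, 0 ≤ h k := fun k =>
    sub_nonneg.2 (wavg_mono hp fun τ hτ _ => H.sample_le τ hτ _)
  set e : ℕ → ℝ := fun k => a * 2 ^ (p + 1) / ((k : ℝ) + 2)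
      * (2 * K * (D * (2 ^ a * a) / ((k : ℝ) + 1)))
      + (ε (k + 1) + ε k) + 2 * r * c / ((k + 2) ^ a : ℕ) with he
  have hsq : Summable fun k : ℕ => 1 / ((k : ℝ) + 1) ^ 2 := by
    have := (summable_nat_add_iff (f := fun n : ℕ => 1 / (n : ℝ) ^ 2) 1).2
      (Real.summable_one_div_nat_pow.2 (by norm_num))
    simpa using this
  have hesum : Summable e := by
    refine Summable.add (Summable.add ?_ (((summable_nat_add_iff 1).2 hε).add hε)) ?_
    · refine Summable.of_nonneg_of_le (fun k => by positivity) (fun k => ?_)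
        (hsq.mul_left (a * 2 ^ (p + 1) * (2 * K * (D * (2 ^ a * a)))))
      calc _ = a * 2 ^ (p + 1) * (2 * K * (D * (2 ^ a * a)))
            * (1 / (((k : ℝ) + 2) * ((k : ℝ) + 1))) := by field_simp
        _ ≤ _ := by
          refine mul_le_mul_of_nonneg_left ?_ (by positivity)
          refine one_div_le_one_div_of_le (by positivity) ?_
          nlinarith [(Nat.cast_nonneg k : (0 : ℝ) ≤ k)]
    · refine Summable.of_nonneg_of_le (fun k => by positivity) (fun k => ?_)
        (hsq.mul_left (2 * r * c))
      rw [mul_one_div]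
      refine div_le_div_of_nonneg_left (by positivity) (by positivity) ?_
      push_cast
      calc ((k : ℝ) + 1) ^ 2 ≤ ((k : ℝ) + 2) ^ 2 := by gcongr; norm_num
        _ ≤ ((k : ℝ) + 2) ^ a :=
          pow_le_pow_right₀ (by linarith [(Nat.cast_nonneg k : (0 : ℝ) ≤ k)]) ha
  have hstep : ∀ k : ℕ, u ((k + 1 + 1) ^ a)
      ≤ u ((k + 1) ^ a) - (1 / 2 ^ a) ^ p / ((k : ℝ) + 2) * h k + e k := by
    intro k
    set q := d ((k + 1) ^ a) with hq
    have hqC : q ∈ C := H.mem _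
    have h1 := H.surr_along_le (t := (k + 2) ^ a) (one_le_blockStart a (k + 1)) hqC
    have h2 := wavg_block_le hp a (by omega) k (c := fun τ => ℓ τ q - φ τ q)
      (m := 2 * K * (D * (2 ^ a * a) / ((k : ℝ) + 1))) (by positivity)
      (fun τ hτ => sub_nonneg.2 (H.sample_le τ hτ _)) (fun τ h1 h2 => by
        obtain ⟨σ, rfl⟩ := Nat.exists_eq_succ_of_ne_zero (by omega : τ ≠ 0)
        have h3 := (abs_le.1 (H.surr_lip (τ := σ + 1) (by omega) hqC (H.mem σ))).2
        have h4 := (abs_le.1 (H.sample_lip_on (τ := σ + 1) (by omega) hqC (H.mem σ))).1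
        have h5 := H.sample_eq σ
        have h6 := mul_le_mul_of_nonneg_left (hdist k σ (by omega) (by omega)) hK
        simp only [Nat.succ_eq_add_one]
        linarith)
    rw [wavg_sub, wavg_sub] at h2
    have h3 := abs_le.1 (hF (k + 1) q (H.norm_le_three hqC))
    have h4 := abs_le.1 (hF k q (H.norm_le_three hqC))
    have h5 : h k = wavg p ((k + 1) ^ a) (fun τ => ℓ τ q) - wavg p ((k + 1) ^ a) (fun τ => φ τ q) :=
      rfl
    have h6 : u ((k + 1) ^ a) = wavg p ((k + 1) ^ a) (fun τ => ℓ τ q) := rfl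
    rw [h5, h6]
    simp only [he, hu, show k + 1 + 1 = k + 2 from rfl] at h3 ⊢
    linarith [h3.2, h4.1]
  have hhK : ∀ k : ℕ, |h (k + 1) - h k| ≤ 4 * (K' * (2 ^ a * a)) / ((k : ℝ) + 2) := by
    intro k
    have h1 := hblock u hu1 k
    have h2 := hblock f hf1 k
    have h3 : K' * (2 ^ a * a) / ((k : ℝ) + 1) ≤ 2 * (K' * (2 ^ a * a)) / ((k : ℝ) + 2) := by
      rw [div_le_div_iff₀ (by positivity) (by positivity)]
      have : 0 ≤ K' * (2 ^ a * (a : ℝ)) := by positivity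
      nlinarith [(Nat.cast_nonneg k : (0 : ℝ) ≤ k)]
    have h4 : h (k + 1) - h k = (u ((k + 2) ^ a) - u ((k + 1) ^ a))
        - (f ((k + 2) ^ a) - f ((k + 1) ^ a)) := by
      simp only [hh, show k + 1 + 1 = k + 2 from rfl]; ring
    rw [h4]
    have h5 := abs_sub (u ((k + 2) ^ a) - u ((k + 1) ^ a)) (f ((k + 2) ^ a) - f ((k + 1) ^ a))
    have h6 : 4 * (K' * (2 ^ a * a)) / ((k : ℝ) + 2) = 2 * (K' * (2 ^ a * a)) / ((k : ℝ) + 2)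
      + 2 * (K' * (2 ^ a * a)) / ((k : ℝ) + 2) := by ring
    linarith
  obtain ⟨⟨l, hl⟩, hlim⟩ := tendsto_of_almost_decreasing (u := fun k => u ((k + 1) ^ a))
    (c := (1 / 2 ^ a) ^ p) (by positivity)
    (fun k => wavg_nonneg hp fun τ hτ _ => (H.sample_nonneg τ hτ _).trans (H.sample_le τ hτ _))
    hh0 hesum hstep hhK
  refine ⟨⟨l, tendsto_of_tendsto_blocks hu1 (by omega) hl⟩, ?_⟩
  refine tendsto_of_tendsto_blocks (K := K' + K * D) (a := a) (fun t ht => ?_) (by omega) ?_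
  · have h1 := hu1 t ht
    have h2 := H.limit_lip hε hF (H.norm_le_three (H.mem (t + 1))) (H.norm_le_three (H.mem t))
    have h3 := mul_le_mul_of_nonneg_left (H.dist_succ_le ht) hK
    rw [norm_sub_rev] at h2
    have h4 : (K' + K * D) / ((t + 1 : ℕ) : ℝ) = K' / ((t + 1 : ℕ) : ℝ)
      + K * (D / ((t + 1 : ℕ) : ℝ)) := by ring
    have h5 : u (t + 1) - F (d (t + 1)) - (u t - F (d t)) = (u (t + 1) - u t)
      - (F (d (t + 1)) - F (d t)) := by ring
    change |u (t + 1) - F (d (t + 1)) - (u t - F (d t))| ≤ _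
    rw [h5]
    have h6 := abs_sub (u (t + 1) - u t) (F (d (t + 1)) - F (d t))
    linarith
  · have h1 : Tendsto (fun k => f ((k + 1) ^ a) - F (d ((k + 1) ^ a))) atTop (𝓝 0) :=
      squeeze_zero_norm (fun k => hF k _ (H.norm_le_three (H.mem _))) hε.tendsto_atTop_zero
    have := hlim.add h1
    rw [add_zero] at this
    refine this.congr fun k => ?_
    simp only [hh, hu]
    ring

/-- Cluster points of the iterates at the block starts are stationary: the surrogates lie above
`F` up to a vanishing error, touch it asymptotically at the iterates, and have bounded curvature,
so that a descent direction of `F` at the cluster point would be one of the surrogates. -/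
lemma stationary_of_cluster [CompleteSpace E] (H : SurrogateRun p K r c μ C ℓ φ g d) (ha : 2 ≤ a)
    (hε : Summable ε)
    (hF : ∀ k e, ‖e‖ ≤ 3 * r → |wavg p ((k + 1) ^ a) (fun τ => φ τ e) - F e| ≤ ε k)
    {q : E} (hq : q ∈ C) (hdiff : DifferentiableAt ℝ F q) {ψ : ℕ → ℕ} (hψ : Tendsto ψ atTop atTop)
    (hlim : Tendsto (fun n => d ((ψ n + 1) ^ a)) atTop (𝓝 q)) {e : E} (he : e ∈ C) :
    0 ≤ ⟪∇ F q, e - q⟫ := by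
  have hr := H.r_nonneg
  have hgap := (H.tendsto_surr_along ha hε hF).2
  set w := q - e with hw
  have hwr : ‖w‖ ≤ 2 * r := H.norm_sub_le hq he
  set T : ℕ → ℕ := fun n => (ψ n + 1) ^ a with hT
  have hTtop : Tendsto T atTop atTop :=
    tendsto_atTop_mono (fun n => (Nat.le_succ _).trans (Nat.le_self_pow (by omega) _)) hψ
  have hin : ∀ θ : ℝ, 0 < θ → θ ≤ 1 → ∀ b ∈ C, ‖b + θ • w‖ ≤ 3 * r := by
    intro θ h0 h1 b hb
    have h2 := norm_add_le b (θ • w)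
    rw [norm_smul, Real.norm_of_nonneg h0.le] at h2
    have h3 := H.norm_le b hb
    have h4 := mul_le_mul h1 hwr (norm_nonneg w) zero_le_one
    linarith
  have key : ∀ θ : ℝ, 0 < θ → θ ≤ 1 → F (q + θ • w) - F q ≤ K / 2 * (θ ^ 2 * ‖w‖ ^ 2) := by
    intro θ h0 h1
    -- the comparison of `F` with the surrogate at the `n`-th time
    have hn : ∀ n, F (q + θ • w) - F q ≤
        (wavg p (T n) (fun τ => ℓ τ (d (T n))) - F (d (T n))) + ε (ψ n)
        + (K * ‖q - d (T n)‖ + K * ‖q - d (T n)‖ + θ * (K * ‖q - d (T n)‖)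
          + θ * (2 * r * c * (1 / (T n : ℝ)))) + K / 2 * (θ ^ 2 * ‖w‖ ^ 2) := by
      intro n
      set t := T n
      have ht1 : 1 ≤ t := one_le_blockStart a _
      have hb := hin θ h0 h1 (d t) (H.mem t)
      have e1 := (abs_le.1 (H.limit_lip hε hF (hin θ h0 h1 q hq) hb)).2
      rw [add_sub_add_right_eq_sub] at e1
      have e2 := (abs_le.1 (H.limit_lip hε hF (H.norm_le_three hq)
        (H.norm_le_three (H.mem t)))).1
      have e3 := (abs_le.1 (hF (ψ n) _ hb)).1
      have e4 : wavg p t (fun τ => φ τ (d t + θ • w)) ≤ wavg p t (fun τ => ℓ τ (d t + θ • w)) :=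
        wavg_mono H.p_pos fun τ hτ _ => H.sample_le τ hτ _
      have e5 : wavg p t (fun τ => ℓ τ (d t + θ • w) - ℓ τ (d t))
          - wavg p t (fun τ => ⟪g τ (d t), θ • w⟫) ≤ K / 2 * (θ ^ 2 * ‖w‖ ^ 2) := by
        rw [← wavg_sub, ← wavg_const H.p_pos ht1 (K / 2 * (θ ^ 2 * ‖w‖ ^ 2))]
        refine wavg_mono H.p_pos fun τ hτ _ => ?_
        have := H.smooth τ hτ (d t) (d t + θ • w)
        rw [add_sub_cancel_left, norm_smul, mul_pow, Real.norm_of_nonneg h0.le] at this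
        linarith
      rw [wavg_sub, ← inner_wavg, inner_smul_right] at e5
      have e6 : ⟪wavg p t (fun τ => g τ (d t)), w⟫
          ≤ K * ‖q - d t‖ + 2 * r * c * (1 / (t : ℝ)) := by
        have f1 : w = (q - d t) - (e - d t) := by rw [hw]; abel
        have f2 := H.approx_min t ht1 e he
        have f3 := (abs_le.1 (abs_real_inner_le_norm (wavg p t (fun τ => g τ (d t)))
          (q - d t))).2
        have f4 := mul_le_mul_of_nonneg_right (norm_wavg_le H.p_pos ht1
          (a := fun τ => g τ (d t)) fun τ hτ _ => H.grad_le τ hτ _ (H.mem t))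
          (norm_nonneg (q - d t))
        have f5 : c / t * ‖e - d t‖ ≤ c / t * (2 * r) :=
          mul_le_mul_of_nonneg_left (H.norm_sub_le he (H.mem t))
            (div_nonneg H.c_nonneg (Nat.cast_nonneg t))
        have f6 : 2 * r * c * (1 / (t : ℝ)) = c / t * (2 * r) := by ring
        rw [f1, inner_sub_right]
        linarith
      have e7 := mul_le_mul_of_nonneg_left e6 h0.le
      linarith
    have hnorm : Tendsto (fun n => ‖q - d (T n)‖) atTop (𝓝 0) := by
      have := (tendsto_const_nhds (x := q)).sub hlim
      simpa using this.norm
    have h1T : Tendsto (fun n => 1 / (T n : ℝ)) atTop (𝓝 0) :=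
      tendsto_one_div_atTop_nhds_zero_nat.comp hTtop
    have hright := (((hgap.comp hTtop).add (hε.tendsto_atTop_zero.comp hψ)).add
      ((((hnorm.const_mul K).add (hnorm.const_mul K)).add
        ((hnorm.const_mul K).const_mul θ)).add
          ((h1T.const_mul (2 * r * c)).const_mul θ))).add_const (K / 2 * (θ ^ 2 * ‖w‖ ^ 2))
    simp only [mul_zero, add_zero, zero_add] at hright
    exact ge_of_tendsto' hright hn
  -- one-sided derivative of `F` at `q` in the direction `w`
  have hder : HasDerivAt (fun θ : ℝ => F (q + θ • w)) ⟪∇ F q, w⟫ 0 := by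
    have h1 : HasFDerivAt F (InnerProductSpace.toDual ℝ E (∇ F q)) (q + (0 : ℝ) • w) := by
      rw [zero_smul, add_zero]
      exact hdiff.hasGradientAt.hasFDerivAt
    have h2 : HasDerivAt (fun θ : ℝ => q + θ • w) w 0 := by
      simpa using ((hasDerivAt_id (0 : ℝ)).smul_const w).const_add q
    have h3 := h1.comp_hasDerivAt (0 : ℝ) h2
    rw [InnerProductSpace.toDual_apply_apply] at h3
    exact h3
  have hslope := hder.tendsto_slope_zero_right
  have hbound : Tendsto (fun θ : ℝ => K / 2 * (θ * ‖w‖ ^ 2)) (𝓝[>] 0) (𝓝 0) := by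
    have : Tendsto (fun θ : ℝ => K / 2 * (θ * ‖w‖ ^ 2)) (𝓝 0) (𝓝 (K / 2 * (0 * ‖w‖ ^ 2))) :=
      (by fun_prop : Continuous fun θ : ℝ => K / 2 * (θ * ‖w‖ ^ 2)).tendsto 0
    simp only [zero_mul, mul_zero] at this
    exact this.mono_left nhdsWithin_le_nhds
  have hle : ⟪∇ F q, w⟫ ≤ 0 := by
    refine le_of_tendsto_of_tendsto hslope hbound ?_
    filter_upwards [Ioo_mem_nhdsGT (show (0 : ℝ) < 1 by norm_num)] with θ hθ
    have := key θ hθ.1 hθ.2.le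
    simp only [zero_add, zero_smul, add_zero, smul_eq_mul]
    rw [inv_mul_le_iff₀ hθ.1]
    linarith
  have : e - q = -w := by rw [hw, neg_sub]
  rw [this, inner_neg_right]
  linarith

/-- The iterates approach the set of stationary points. -/
lemma tendsto_infDist [CompleteSpace E] (H : SurrogateRun p K r c μ C ℓ φ g d) (ha : 2 ≤ a)
    (hε : Summable ε)
    (hF : ∀ k e, ‖e‖ ≤ 3 * r → |wavg p ((k + 1) ^ a) (fun τ => φ τ e) - F e| ≤ ε k)
    (hC : IsCompact C) (hdiff : ∀ q ∈ closure (Set.range d), DifferentiableAt ℝ F q)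
    {V : Set E} (hV : ∀ q, q ∈ C → DifferentiableAt ℝ F q → (∀ e ∈ C, 0 ≤ ⟪∇ F q, e - q⟫) → q ∈ V) :
    V.Nonempty ∧ Tendsto (fun t => Metric.infDist (d t) V) atTop (𝓝 0) := by
  have hcl : ∀ ψ : ℕ → ℕ, Tendsto ψ atTop atTop → ∃ q ∈ V, ∃ χ : ℕ → ℕ,
      Tendsto (fun n => d ((ψ (χ n) + 1) ^ a)) atTop (𝓝 q) := by
    intro ψ hψ
    obtain ⟨q, hq, χ, hχ, hlim⟩ := hC.tendsto_subseq fun n => H.mem ((ψ n + 1) ^ a)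
    have hqd : DifferentiableAt ℝ F q := hdiff q
      (mem_closure_of_tendsto hlim (Eventually.of_forall fun n => Set.mem_range_self _))
    refine ⟨q, hV q hq hqd fun e he => ?_, χ, hlim⟩
    exact H.stationary_of_cluster ha hε hF hq hqd (hψ.comp hχ.tendsto_atTop) hlim he
  obtain ⟨q0, hq0, -⟩ := hcl id tendsto_id
  refine ⟨⟨q0, hq0⟩, ?_⟩
  refine tendsto_of_tendsto_blocks (K := (3 * c + 2 * K * 2 ^ (p + 1)) / μ) (a := a)
    (fun t ht => ?_) (by omega) ?_
  · have h1 := (Metric.lipschitz_infDist_pt V).dist_le_mul (d (t + 1)) (d t)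
    rw [NNReal.coe_one, one_mul, Real.dist_eq, dist_comm, dist_eq_norm] at h1
    exact h1.trans (H.dist_succ_le ht)
  · refine tendsto_of_subseq_tendsto fun ψ hψ => ?_
    obtain ⟨q, hq, χ, hlim⟩ := hcl ψ hψ
    refine ⟨χ, squeeze_zero (fun _ => Metric.infDist_nonneg)
      (fun n => Metric.infDist_le_dist_of_mem hq) ?_⟩
    exact tendsto_iff_dist_tendsto_zero.1 hlim

end SurrogateRun

/-! ### The loss as a function of the dictionary -/

section Loss

variable {N M L : ℕ}

@[simp] lemma convSum_apply (d : Dict M L) (x : Coef M N) (i : ZMod N) :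
    convSum d x i = ∑ m : Fin M, ∑ l : Fin L, d (m, l) * x (m, i - ((l : ℕ) : ZMod N)) := rfl

/-- The map `d ↦ ∑_m d_m ∗ x_m` as a linear map. -/
def convLin (L : ℕ) (x : Coef M N) : Dict M L →ₗ[ℝ] Signal N where
  toFun d := convSum d x
  map_add' d e := by
    ext i
    simp [add_mul, Finset.sum_add_distrib]
  map_smul' c d := by
    ext i
    simp [Finset.mul_sum, mul_assoc]

lemma convSum_add (d e : Dict M L) (x : Coef M N) :
    convSum (d + e) x = convSum d x + convSum e x := map_add (convLin L x) d e

lemma convSum_sub (d e : Dict M L) (x : Coef M N) :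
    convSum (d - e) x = convSum d x - convSum e x := map_sub (convLin L x) d e

lemma convSum_zero_right (d : Dict M L) : convSum d (0 : Coef M N) = 0 := by
  ext i
  simp

lemma continuous_convSum : Continuous fun q : Dict M L × Coef M N => convSum q.1 q.2 := by
  unfold convSum
  fun_prop

lemma tendsto_convSum {α : Type*} {l : Filter α} {d : α → Dict M L} {x : α → Coef M N}
    {d₀ : Dict M L} {x₀ : Coef M N} (hd : Tendsto d l (𝓝 d₀)) (hx : Tendsto x l (𝓝 x₀)) :
    Tendsto (fun a => convSum (d a) (x a)) l (𝓝 (convSum d₀ x₀)) := by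
  have h := (continuous_convSum.tendsto (d₀, x₀)).comp (hd.prodMk_nhds hx)
  exact h

lemma norm_le_sum_abs {ι : Type*} [Fintype ι] (v : EuclideanSpace ℝ ι) : ‖v‖ ≤ ∑ i, |v i| := by
  rw [EuclideanSpace.norm_eq, Real.sqrt_le_left (Finset.sum_nonneg fun i _ => abs_nonneg _)]
  simpa using Finset.sum_sq_le_sq_sum_of_nonneg (s := Finset.univ) (f := fun i => |v i|)
    fun i _ => abs_nonneg _

lemma abs_apply_le_norm {ι : Type*} [Fintype ι] (v : EuclideanSpace ℝ ι) (i : ι) :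
    |v i| ≤ ‖v‖ := PiLp.norm_apply_le v i

/-- An upper bound for the norm of the operator `d ↦ ∑_m d_m ∗ x_m`, uniform over the sparse
codes `x` of signals of norm at most `R`. -/
def codeBound (N M L : ℕ) (lam R : ℝ) : ℝ := (N * (M * L) : ℝ) * (R ^ 2 / (2 * lam))

lemma codeBound_nonneg {lam : ℝ} (hlam : 0 < lam) (R : ℝ) : 0 ≤ codeBound N M L lam R := by
  unfold codeBound
  positivity

variable [NeZero N]

lemma norm_convSum_le (d : Dict M L) (x : Coef M N) :
    ‖convSum d x‖ ≤ (N * (M * L) : ℝ) * (‖d‖ * ‖x‖) := by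
  refine (norm_le_sum_abs _).trans ?_
  have h : ∀ i : ZMod N, |convSum d x i| ≤ (M * L : ℝ) * (‖d‖ * ‖x‖) := by
    intro i
    rw [convSum_apply]
    calc _ ≤ ∑ m : Fin M, ∑ l : Fin L, ‖d‖ * ‖x‖ := by
          refine (Finset.abs_sum_le_sum_abs _ _).trans (Finset.sum_le_sum fun m _ => ?_)
          refine (Finset.abs_sum_le_sum_abs _ _).trans (Finset.sum_le_sum fun l _ => ?_)
          rw [abs_mul]
          exact mul_le_mul (abs_apply_le_norm _ _) (abs_apply_le_norm _ _) (abs_nonneg _)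
            (norm_nonneg _)
      _ = _ := by simp; ring
  calc _ ≤ ∑ _i : ZMod N, (M * L : ℝ) * (‖d‖ * ‖x‖) := Finset.sum_le_sum fun i _ => h i
    _ = _ := by simp [ZMod.card]; ring

/-- The gradient `Xᵀ (X d - s)` of the loss with respect to the dictionary. -/
def lossGrad (d : Dict M L) (x : Coef M N) (s : Signal N) : Dict M L :=
  WithLp.toLp 2 fun q => ∑ i : ZMod N,
    x (q.1, i - ((q.2 : ℕ) : ZMod N)) * (convSum d x i - s i)

lemma inner_lossGrad (d v : Dict M L) (x : Coef M N) (s : Signal N) :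
    ⟪lossGrad d x s, v⟫ = ⟪convSum d x - s, convSum v x⟫ := by
  simp only [PiLp.inner_apply, lossGrad, RCLike.inner_apply, conj_trivial,
    PiLp.sub_apply, convSum_apply v x]
  rw [Fintype.sum_prod_type]
  simp only [Finset.mul_sum, Finset.sum_mul]
  symm
  rw [Finset.sum_comm]
  refine Finset.sum_congr rfl fun m _ => ?_
  rw [Finset.sum_comm]
  refine Finset.sum_congr rfl fun l _ => Finset.sum_congr rfl fun i _ => ?_
  ring

lemma loss_add (lam : ℝ) (d v : Dict M L) (x : Coef M N) (s : Signal N) :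
    loss lam (d + v) x s = loss lam d x s + ⟪lossGrad d x s, v⟫ + 1 / 2 * ‖convSum v x‖ ^ 2 := by
  rw [inner_lossGrad, loss, loss, convSum_add, add_sub_right_comm, norm_add_sq_real]
  ring

lemma hasGradientAt_loss (lam : ℝ) (d : Dict M L) (x : Coef M N) (s : Signal N) :
    HasGradientAt (fun d => loss lam d x s) (lossGrad d x s) d := by
  rw [hasGradientAt_iff_hasFDerivAt]
  have h1 : HasFDerivAt (fun e : Dict M L => convSum e x - s)
      (LinearMap.toContinuousLinearMap (convLin L x)) d :=
    (LinearMap.toContinuousLinearMap (convLin L x)).hasFDerivAt.sub_const s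
  have h2 := (h1.norm_sq.const_mul (1 / 2 : ℝ)).add_const (lam * ∑ q, |x q|)
  refine h2.congr_fderiv ?_
  ext v
  simp only [InnerProductSpace.toDual_apply_apply, inner_lossGrad, smul_apply,
    ContinuousLinearMap.comp_apply, innerSL_apply_apply, smul_eq_mul, nsmul_eq_mul]
  change 1 / 2 * (2 * ⟪convSum d x - s, convSum v x⟫) = _
  ring

section Limits

variable {α : Type*} {l : Filter α} {d : α → Dict M L} {x : α → Coef M N} {s : α → Signal N}
  {d₀ : Dict M L} {x₀ : Coef M N} {s₀ : Signal N}

lemma tendsto_loss (lam : ℝ) (hd : Tendsto d l (𝓝 d₀)) (hx : Tendsto x l (𝓝 x₀))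
    (hs : Tendsto s l (𝓝 s₀)) :
    Tendsto (fun a => loss lam (d a) (x a) (s a)) l (𝓝 (loss lam d₀ x₀ s₀)) := by
  have hcont : Continuous fun x : Coef M N => ∑ q, |x q| := by fun_prop
  have h1 := (hcont.tendsto x₀).comp hx
  have h2 := ((((tendsto_convSum hd hx).sub hs).norm.pow 2).const_mul (1 / 2)).add
    (h1.const_mul lam)
  exact h2

lemma tendsto_lossGrad (hd : Tendsto d l (𝓝 d₀)) (hx : Tendsto x l (𝓝 x₀))
    (hs : Tendsto s l (𝓝 s₀)) :
    Tendsto (fun a => lossGrad (d a) (x a) (s a)) l (𝓝 (lossGrad d₀ x₀ s₀)) := by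
  have hcont : Continuous fun q : Coef M N × Signal N => (WithLp.toLp 2 fun r : Fin M × Fin L =>
      ∑ i : ZMod N, q.1 (r.1, i - ((r.2 : ℕ) : ZMod N)) * q.2 i : Dict M L) := by
    fun_prop
  have h := (hcont.tendsto (x₀, convSum d₀ x₀ - s₀)).comp
    (hx.prodMk_nhds ((tendsto_convSum hd hx).sub hs))
  exact h

end Limits

/-! ### Sparse codes and the minimal loss -/

variable {lam : ℝ}

lemma loss_nonneg (hlam : 0 < lam) (d : Dict M L) (x : Coef M N) (s : Signal N) :
    0 ≤ loss lam d x s := by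
  have : 0 ≤ ∑ q, |x q| := Finset.sum_nonneg fun q _ => abs_nonneg _
  unfold loss
  positivity

lemma loss_zero_right (lam : ℝ) (d : Dict M L) (s : Signal N) :
    loss lam d (0 : Coef M N) s = 1 / 2 * ‖s‖ ^ 2 := by
  simp [loss, convSum_zero_right]

lemma norm_le_of_loss_le (hlam : 0 < lam) {d : Dict M L} {x : Coef M N} {s : Signal N}
    (h : loss lam d x s ≤ loss lam d 0 s) : ‖x‖ ≤ ‖s‖ ^ 2 / (2 * lam) := by
  refine (norm_le_sum_abs x).trans ?_
  rw [loss_zero_right, loss] at h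
  rw [le_div_iff₀ (by positivity)]
  nlinarith [sq_nonneg ‖convSum d x - s‖]

lemma exists_isSparseCode (hlam : 0 < lam) (d : Dict M L) (s : Signal N) :
    ∃ x : Coef M N, IsSparseCode lam d s x := by
  have hcont : Continuous fun x : Coef M N => loss lam d x s :=
    continuous_iff_continuousAt.2 fun x =>
      tendsto_loss lam tendsto_const_nhds tendsto_id tendsto_const_nhds
  obtain ⟨x, hx, hmin⟩ := (isCompact_closedBall (0 : Coef M N) (‖s‖ ^ 2 / (2 * lam))).exists_isMinOn
    (Metric.nonempty_closedBall.2 (by positivity)) hcont.continuousOn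
  refine ⟨x, fun y => ?_⟩
  by_cases hy : loss lam d y s ≤ loss lam d 0 s
  · exact hmin (mem_closedBall_zero_iff.2 (norm_le_of_loss_le hlam hy))
  · exact (hmin (mem_closedBall_zero_iff.2 (norm_le_of_loss_le hlam (d := d) le_rfl))).trans
      (not_le.1 hy).le

lemma bddBelow_loss (hlam : 0 < lam) (d : Dict M L) (s : Signal N) :
    BddBelow (Set.range fun x : Coef M N => loss lam d x s) :=
  ⟨0, by rintro _ ⟨x, rfl⟩; exact loss_nonneg hlam d x s⟩

lemma minLoss_le {M L : ℕ} (hlam : 0 < lam) (d : Dict M L) (x : Coef M N) (s : Signal N) :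
    minLoss lam d s ≤ loss lam d x s := ciInf_le (bddBelow_loss hlam d s) x

lemma minLoss_nonneg {M L : ℕ} (hlam : 0 < lam) (d : Dict M L) (s : Signal N) :
    0 ≤ minLoss lam d s := le_ciInf fun x => loss_nonneg hlam d x s

lemma IsSparseCode.minLoss_eq (hlam : 0 < lam) {d : Dict M L} {s : Signal N} {x : Coef M N}
    (h : IsSparseCode lam d s x) : minLoss lam d s = loss lam d x s :=
  le_antisymm (minLoss_le hlam d x s) (le_ciInf h)

lemma minLoss_le_norm {M L : ℕ} (hlam : 0 < lam) (d : Dict M L) (s : Signal N) :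
    minLoss lam d s ≤ 1 / 2 * ‖s‖ ^ 2 := by
  rw [← loss_zero_right lam d s]
  exact minLoss_le hlam d 0 s

lemma IsSparseCode.norm_le (hlam : 0 < lam) {d : Dict M L} {s : Signal N} {x : Coef M N}
    (h : IsSparseCode lam d s x) : ‖x‖ ≤ ‖s‖ ^ 2 / (2 * lam) :=
  norm_le_of_loss_le hlam (h 0)

lemma IsSparseCode.penalty_le {d : Dict M L} {s : Signal N} {x : Coef M N}
    (h : IsSparseCode lam d s x) : lam * ∑ q, |x q| ≤ 1 / 2 * ‖s‖ ^ 2 := by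
  have h1 := h 0
  rw [loss_zero_right, loss] at h1
  nlinarith [sq_nonneg ‖convSum d x - s‖]

lemma IsSparseCode.norm_convSum_le (hlam : 0 < lam) {d : Dict M L} {s : Signal N} {x : Coef M N}
    (h : IsSparseCode lam d s x) {R : ℝ} (hs : ‖s‖ ≤ R) (v : Dict M L) :
    ‖convSum v x‖ ≤ codeBound N M L lam R * ‖v‖ := by
  refine (OCDL.norm_convSum_le v x).trans ?_
  have h1 : ‖x‖ ≤ R ^ 2 / (2 * lam) := (h.norm_le hlam).trans (by gcongr)
  calc _ ≤ (N * (M * L) : ℝ) * (‖v‖ * (R ^ 2 / (2 * lam))) := by gcongr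
    _ = _ := by rw [codeBound]; ring

lemma norm_lossGrad_le {x : Coef M N} {A : ℝ} (hA : ∀ v : Dict M L, ‖convSum v x‖ ≤ A * ‖v‖)
    (hA0 : 0 ≤ A) (d : Dict M L) (s : Signal N) :
    ‖lossGrad d x s‖ ≤ A * (A * ‖d‖ + ‖s‖) := by
  set G := lossGrad d x s with hG
  have h1 : ‖G‖ * ‖G‖ ≤ A * (A * ‖d‖ + ‖s‖) * ‖G‖ := by
    rw [← real_inner_self_eq_norm_mul_norm, hG, inner_lossGrad, ← hG]
    calc _ ≤ ‖convSum d x - s‖ * ‖convSum G x‖ := real_inner_le_norm _ _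
      _ ≤ (A * ‖d‖ + ‖s‖) * (A * ‖G‖) := by
        refine mul_le_mul ((norm_sub_le _ _).trans ?_) (hA G) (norm_nonneg _) (by positivity)
        gcongr
        exact hA d
      _ = _ := by ring
  rcases (norm_nonneg G).eq_or_lt with h0 | h0
  · rw [← h0]; positivity
  · exact le_of_mul_le_mul_right h1 h0

lemma norm_lossGrad_sub_le {x : Coef M N} {A : ℝ} (hA : ∀ v : Dict M L, ‖convSum v x‖ ≤ A * ‖v‖)
    (hA0 : 0 ≤ A) (d e : Dict M L) (s : Signal N) :
    ‖lossGrad d x s - lossGrad e x s‖ ≤ A ^ 2 * ‖d - e‖ := by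
  have h : lossGrad d x s - lossGrad e x s = lossGrad (d - e) x 0 := by
    ext q
    simp only [lossGrad, PiLp.sub_apply, convSum_sub, ← Finset.sum_sub_distrib, PiLp.zero_apply]
    refine Finset.sum_congr rfl fun i _ => ?_
    ring
  rw [h]
  refine (norm_lossGrad_le hA hA0 _ _).trans (le_of_eq ?_)
  rw [norm_zero]
  ring

lemma IsSparseCode.loss_le (hlam : 0 < lam) {d : Dict M L} {s : Signal N} {x : Coef M N}
    (h : IsSparseCode lam d s x) {R ρ : ℝ} (hs : ‖s‖ ≤ R) {e : Dict M L} (he : ‖e‖ ≤ ρ) :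
    loss lam e x s ≤ 1 / 2 * (codeBound N M L lam R * ρ + R) ^ 2 + 1 / 2 * R ^ 2 := by
  have hA0 := codeBound_nonneg (N := N) (M := M) (L := L) hlam R
  have h1 := h.norm_convSum_le hlam hs e
  have h2 : ‖convSum e x - s‖ ≤ codeBound N M L lam R * ρ + R :=
    (norm_sub_le _ _).trans (add_le_add (h1.trans (by gcongr)) hs)
  have h3 := h.penalty_le
  have h4 : ‖s‖ ^ 2 ≤ R ^ 2 := by gcongr
  have h5 : ‖convSum e x - s‖ ^ 2 ≤ (codeBound N M L lam R * ρ + R) ^ 2 := by gcongr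
  unfold loss
  linarith

/-- The minimal loss is Lipschitz in the dictionary on bounded sets: compare the loss at one
dictionary with the loss of its sparse code at the other. -/
lemma abs_minLoss_sub_le (hlam : 0 < lam) {s : Signal N} {R ρ : ℝ} (hs : ‖s‖ ≤ R)
    {e e' : Dict M L} (he : ‖e‖ ≤ ρ) (he' : ‖e'‖ ≤ ρ) :
    |minLoss lam e s - minLoss lam e' s| ≤
      codeBound N M L lam R * (2 * codeBound N M L lam R * ρ + R) * ‖e - e'‖ := by
  set A := codeBound N M L lam R with hA
  have hA0 : 0 ≤ A := codeBound_nonneg hlam R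
  have key : ∀ e e' : Dict M L, ‖e‖ ≤ ρ → ‖e'‖ ≤ ρ →
      minLoss lam e s - minLoss lam e' s ≤ A * (2 * A * ρ + R) * ‖e - e'‖ := by
    intro e e' he he'
    obtain ⟨x, hx⟩ := exists_isSparseCode hlam e' s
    have h1 := minLoss_le hlam e x s
    have h2 := hx.minLoss_eq hlam
    have h3 := loss_add lam e' (e - e') x s
    rw [add_sub_cancel] at h3
    have hAx := hx.norm_convSum_le hlam hs
    have h4 := real_inner_le_norm (lossGrad e' x s) (e - e')
    have h5 : ‖lossGrad e' x s‖ ≤ A * (A * ρ + R) :=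
      (norm_lossGrad_le hAx hA0 e' s).trans (by gcongr)
    have h6 := mul_le_mul_of_nonneg_right h5 (norm_nonneg (e - e'))
    have h7 : ‖convSum (e - e') x‖ ^ 2 ≤ (A * ‖e - e'‖) ^ 2 := by
      gcongr
      exact hAx _
    have h8 : ‖e - e'‖ ≤ 2 * ρ := (norm_sub_le _ _).trans (by linarith)
    have h9 : A ^ 2 * ‖e - e'‖ * ‖e - e'‖ ≤ A ^ 2 * ‖e - e'‖ * (2 * ρ) := by gcongr
    nlinarith
  rw [abs_sub_le_iff]
  exact ⟨key e e' he he', norm_sub_rev e e' ▸ key e' e he' he⟩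

lemma measurable_minLoss (hlam : 0 < lam) (d : Dict M L) :
    Measurable fun s : Signal N => minLoss lam d s := by
  refine UpperSemicontinuous.measurable ?_
  refine upperSemicontinuous_ciInf (fun s => bddBelow_loss hlam d s) fun x => ?_
  exact Continuous.upperSemicontinuous <| continuous_iff_continuousAt.2 fun s =>
    tendsto_loss lam tendsto_const_nhds tendsto_const_nhds tendsto_id

/-! ### Differentiability of the expected loss -/

/-- A chosen solution of the sparse coding problem. -/
def sparseCode (hlam : 0 < lam) (d : Dict M L) (s : Signal N) : Coef M N :=
  (exists_isSparseCode hlam d s).choose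

lemma isSparseCode_sparseCode (hlam : 0 < lam) (d : Dict M L) (s : Signal N) :
    IsSparseCode lam d s (sparseCode hlam d s) :=
  (exists_isSparseCode hlam d s).choose_spec

/-- Sparse codes depend continuously on the dictionary and the signal wherever they are unique:
nearby codes are bounded and their cluster points are optimal. -/
lemma tendsto_sparseCode (hlam : 0 < lam) {α : Type*} {l : Filter α} [l.IsCountablyGenerated]
    {e : α → Dict M L} {s : α → Signal N} {D : Dict M L} {σ : Signal N}
    (he : Tendsto e l (𝓝 D)) (hs : Tendsto s l (𝓝 σ))
    (huniq : ∃! y : Coef M N, IsSparseCode lam D σ y) :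
    Tendsto (fun a => sparseCode hlam (e a) (s a)) l (𝓝 (sparseCode hlam D σ)) := by
  refine tendsto_of_seq_tendsto fun q hq => tendsto_of_subseq_tendsto fun ψ hψ => ?_
  have he1 := (he.comp hq).comp hψ
  have hs1 := (hs.comp hq).comp hψ
  obtain ⟨R, hR⟩ := hs1.norm.bddAbove_range
  have hb : ∀ n, sparseCode hlam (e (q (ψ n))) (s (q (ψ n))) ∈
      Metric.closedBall (0 : Coef M N) (R ^ 2 / (2 * lam)) := fun n => by
    rw [mem_closedBall_zero_iff]
    refine ((isSparseCode_sparseCode hlam _ _).norm_le hlam).trans ?_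
    have : ‖s (q (ψ n))‖ ≤ R := hR ⟨n, rfl⟩
    gcongr
  obtain ⟨y, -, χ, hχ, hy⟩ := (isCompact_closedBall _ _).tendsto_subseq hb
  have he2 := he1.comp hχ.tendsto_atTop
  have hs2 := hs1.comp hχ.tendsto_atTop
  have hycode : IsSparseCode lam D σ y := fun z =>
    le_of_tendsto_of_tendsto' (tendsto_loss lam he2 hy hs2)
      (tendsto_loss lam he2 (tendsto_const_nhds (x := z)) hs2)
      fun n => isSparseCode_sparseCode hlam _ _ z
  refine ⟨χ, ?_⟩
  rw [huniq.unique (isSparseCode_sparseCode hlam D σ) hycode]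
  exact hy

/-- The envelope theorem: where the sparse code is unique, the minimal loss is differentiable and
its gradient is the partial gradient of the loss at the sparse code. -/
lemma hasGradientAt_minLoss (hlam : 0 < lam) {D : Dict M L} {σ : Signal N}
    (huniq : ∃! y : Coef M N, IsSparseCode lam D σ y) :
    HasGradientAt (fun d => minLoss lam d σ) (lossGrad D (sparseCode hlam D σ) σ) D := by
  rw [hasGradientAt_iff_isLittleO, Asymptotics.isLittleO_iff]
  intro c hc
  set x₀ := sparseCode hlam D σ with hx₀
  have hx₀c := isSparseCode_sparseCode hlam D σ
  set A := codeBound N M L lam ‖σ‖ with hA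
  have hA0 : 0 ≤ A := codeBound_nonneg hlam _
  have hcode : Tendsto (fun e => lossGrad D (sparseCode hlam e σ) σ) (𝓝 D)
      (𝓝 (lossGrad D x₀ σ)) :=
    tendsto_lossGrad tendsto_const_nhds
      (tendsto_sparseCode hlam tendsto_id tendsto_const_nhds huniq) tendsto_const_nhds
  have hsmall : ∀ᶠ e in 𝓝 D, A ^ 2 * ‖e - D‖ < c := by
    have : Tendsto (fun e => A ^ 2 * ‖e - D‖) (𝓝 D) (𝓝 (A ^ 2 * ‖D - D‖)) :=
      (by fun_prop : Continuous fun e => A ^ 2 * ‖e - D‖).tendsto D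
    rw [sub_self, norm_zero, mul_zero] at this
    exact this.eventually_lt_const hc
  filter_upwards [hsmall, Metric.tendsto_nhds.1 hcode c hc] with e he1 he2
  rw [dist_eq_norm] at he2
  set x := sparseCode hlam e σ
  have hxc := isSparseCode_sparseCode hlam e σ
  have hn := norm_nonneg (e - D)
  rw [Real.norm_eq_abs, abs_le]
  constructor
  · have h1 := minLoss_le hlam D x σ
    have h2 := hxc.minLoss_eq hlam
    have h3 := loss_add lam D (e - D) x σ
    rw [add_sub_cancel] at h3
    have h4 := (abs_le.1 (abs_real_inner_le_norm
      (lossGrad D x σ - lossGrad D x₀ σ) (e - D))).1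
    rw [inner_sub_left] at h4
    have h5 := mul_le_mul_of_nonneg_right he2.le hn
    have h6 := sq_nonneg ‖convSum (e - D) x‖
    linarith
  · have h1 := minLoss_le hlam e x₀ σ
    have h2 := hx₀c.minLoss_eq hlam
    have h3 := loss_add lam D (e - D) x₀ σ
    rw [add_sub_cancel] at h3
    have h4 : ‖convSum (e - D) x₀‖ ^ 2 ≤ (A * ‖e - D‖) ^ 2 := by
      gcongr
      exact hx₀c.norm_convSum_le hlam le_rfl _
    have h5 := mul_le_mul_of_nonneg_right he1.le hn
    have h6 : 0 ≤ (A * ‖e - D‖) ^ 2 := sq_nonneg _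
    rw [← hx₀] at h2
    nlinarith

variable {PS : Measure (Signal N)}

lemma ae_norm_le_of_isCompact_support (hsupp : IsCompact PS.support) :
    ∃ R : ℝ, 0 ≤ R ∧ ∀ᵐ σ ∂PS, ‖σ‖ ≤ R := by
  obtain ⟨R, hR⟩ := hsupp.isBounded.exists_norm_le
  refine ⟨max R 0, le_max_right _ _, ?_⟩
  filter_upwards [Measure.support_mem_ae (μ := PS)] with σ hσ
  exact (hR σ hσ).trans (le_max_left _ _)

variable [IsProbabilityMeasure PS]

lemma integrable_minLoss (hlam : 0 < lam) (hsupp : IsCompact PS.support) (d : Dict M L) :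
    Integrable (fun σ => minLoss lam d σ) PS := by
  obtain ⟨R, -, hR⟩ := ae_norm_le_of_isCompact_support hsupp
  refine Integrable.of_bound (measurable_minLoss hlam d).aestronglyMeasurable (1 / 2 * R ^ 2) ?_
  filter_upwards [hR] with σ hσ
  rw [Real.norm_of_nonneg (minLoss_nonneg hlam d σ)]
  exact (minLoss_le_norm hlam d σ).trans (by gcongr)

/-- The expected loss is differentiable at every dictionary for which almost all signals have a
unique sparse code. -/
lemma differentiableAt_expectedLoss (hlam : 0 < lam) (hsupp : IsCompact PS.support) {D : Dict M L}
    (huniq : ∀ σ ∈ PS.support, ∃! y : Coef M N, IsSparseCode lam D σ y) :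
    DifferentiableAt ℝ (expectedLoss lam PS) D := by
  obtain ⟨R, hR0, hR⟩ := ae_norm_le_of_isCompact_support hsupp
  set K := codeBound N M L lam R * (2 * codeBound N M L lam R * (‖D‖ + 1) + R)
  have hmeas : AEStronglyMeasurable (fun σ => InnerProductSpace.toDual ℝ (Dict M L)
      (lossGrad D (sparseCode hlam D σ) σ)) PS := by
    have hcont : ContinuousOn (fun σ => lossGrad D (sparseCode hlam D σ) σ) PS.support :=
      fun σ hσ => ContinuousAt.continuousWithinAt <|
        tendsto_lossGrad tendsto_const_nhds (tendsto_sparseCode hlam tendsto_const_nhds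
          tendsto_id (huniq σ hσ)) tendsto_id
    have hm := hcont.aestronglyMeasurable (μ := PS) hsupp.isClosed.measurableSet
    rw [Measure.restrict_eq_self_of_ae_mem (s := PS.support)
      (Measure.support_mem_ae (μ := PS))] at hm
    exact (InnerProductSpace.toDual ℝ (Dict M L)).continuous.comp_aestronglyMeasurable hm
  refine (hasFDerivAt_integral_of_dominated_loc_of_lip' (s := Metric.ball D 1)
    (F := fun d σ => minLoss lam d σ) (bound := fun _ => K)
    (Metric.ball_mem_nhds D one_pos)
    (fun d _ => (measurable_minLoss hlam d).aestronglyMeasurable)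
    (integrable_minLoss hlam hsupp D) hmeas ?_ (integrable_const _) ?_).2.differentiableAt
  · filter_upwards [hR] with σ hσ e he
    refine abs_minLoss_sub_le hlam hσ ?_ (by linarith)
    have := norm_le_norm_add_norm_sub' e D
    rw [Metric.mem_ball, dist_eq_norm] at he
    linarith
  · filter_upwards [Measure.support_mem_ae (μ := PS)] with σ hσ
    exact (hasGradientAt_minLoss hlam (huniq σ hσ)).hasFDerivAt

end Loss

/-! ### A uniform law of large numbers with a summable rate -/

section UniformLLN

variable {Ω S : Type*} [MeasurableSpace Ω] [MeasurableSpace S] {P : Measure Ω}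

lemma ae_summable_of_integral_le {G : ℕ → Ω → ℝ} {b : ℕ → ℝ} (h0 : ∀ k ω, 0 ≤ G k ω)
    (hG : ∀ k, Integrable (G k) P) (hGb : ∀ k, ∫ ω, G k ω ∂P ≤ b k) (hb : Summable b) :
    ∀ᵐ ω ∂P, Summable fun k => G k ω := by
  have hb0 : ∀ k, 0 ≤ b k := fun k => (integral_nonneg (h0 k)).trans (hGb k)
  have h1 : ∫⁻ ω, ∑' k, ENNReal.ofReal (G k ω) ∂P ≠ ⊤ := by
    rw [lintegral_tsum fun k => (hG k).aemeasurable.ennreal_ofReal]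
    refine ne_top_of_le_ne_top hb.tsum_ofReal_ne_top (ENNReal.tsum_le_tsum fun k => ?_)
    rw [← ofReal_integral_eq_lintegral_ofReal (hG k) (Eventually.of_forall (h0 k))]
    exact ENNReal.ofReal_le_ofReal (hGb k)
  have h2 := ae_lt_top' (AEMeasurable.tsum fun k =>
    (hG k).aemeasurable.ennreal_ofReal) h1
  filter_upwards [h2] with ω hω
  have h3 := ENNReal.summable_toReal hω.ne
  refine h3.congr fun k => ?_
  rw [ENNReal.toReal_ofReal (h0 k ω)]

variable [IsProbabilityMeasure P] {PS : Measure S} {X : ℕ → Ω → S}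

/-- The variance of a weighted empirical mean of bounded random variables is `O(1 / Λ^{(t)})`. -/
lemma integral_sq_wavg_sub_le {p : ℝ} (hp : 0 < p) (hX : ∀ t, Measurable (X (t + 1)))
    (hlaw : ∀ t, P.map (X (t + 1)) = PS) (hindep : iIndepFun (fun t : ℕ => X (t + 1)) P)
    {f : S → ℝ} (hf : Measurable f) {B : ℝ} (hB : ∀ᵐ σ ∂PS, |f σ| ≤ B) {t : ℕ} (ht : 1 ≤ t) :
    Integrable (fun ω => (wavg p t (fun τ => f (X τ ω)) - ∫ σ, f σ ∂PS) ^ 2) P ∧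
    ∫ ω, (wavg p t (fun τ => f (X τ ω)) - ∫ σ, f σ ∂PS) ^ 2 ∂P ≤ B ^ 2 / weightSum p t := by
  have hΛ := weightSum_pos hp ht
  set w : ℕ → ℝ := fun τ => 1 / weightSum p t * ((τ : ℝ) / (t : ℝ)) ^ p with hw
  have hw0 : ∀ τ, 0 ≤ w τ := fun τ => mul_nonneg (by positivity) (weight_nonneg p τ t)
  have hw1 : ∑ τ ∈ Finset.Icc 1 t, w τ = 1 := by
    rw [hw, ← Finset.mul_sum]
    change 1 / weightSum p t * weightSum p t = 1
    field_simp
  have hae : ∀ τ, 1 ≤ τ → ∀ᵐ ω ∂P, |f (X τ ω)| ≤ B := fun τ hτ => by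
    obtain ⟨τ, rfl⟩ := Nat.exists_eq_add_of_le' hτ
    refine ae_of_ae_map (hX τ).aemeasurable (p := fun σ => |f σ| ≤ B) ?_
    rw [hlaw]
    exact hB
  have hmeas : ∀ τ, 1 ≤ τ → Measurable fun ω => f (X τ ω) := fun τ hτ => by
    obtain ⟨τ, rfl⟩ := Nat.exists_eq_add_of_le' hτ
    exact hf.comp (hX τ)
  have hLp : ∀ τ, 1 ≤ τ → MemLp (fun ω => f (X τ ω)) 2 P := fun τ hτ =>
    MemLp.of_bound (hmeas τ hτ).aestronglyMeasurable B (hae τ hτ)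
  have hint : ∀ τ, 1 ≤ τ → ∫ ω, f (X τ ω) ∂P = ∫ σ, f σ ∂PS := fun τ hτ => by
    obtain ⟨τ, rfl⟩ := Nat.exists_eq_add_of_le' hτ
    rw [← hlaw τ, integral_map (hX τ).aemeasurable hf.aestronglyMeasurable]
  set Y : ℕ → Ω → ℝ := fun τ ω => w τ * f (X τ ω) with hY
  have hYLp : ∀ τ ∈ Finset.Icc 1 t, MemLp (Y τ) 2 P := fun τ hτ =>
    (hLp τ (Finset.mem_Icc.1 hτ).1).const_mul (w τ)
  have hsum : (fun ω => wavg p t (fun τ => f (X τ ω))) = ∑ τ ∈ Finset.Icc 1 t, Y τ := by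
    ext ω
    simp only [wavg, hY, hw, Finset.sum_apply, smul_eq_mul, Finset.mul_sum, mul_assoc]
  have hsumLp : MemLp (fun ω => wavg p t (fun τ => f (X τ ω))) 2 P := by
    rw [hsum]
    exact memLp_finsetSum' _ hYLp
  have hmean : ∫ ω, wavg p t (fun τ => f (X τ ω)) ∂P = ∫ σ, f σ ∂PS := by
    have h : ∀ ω, wavg p t (fun τ => f (X τ ω)) = ∑ τ ∈ Finset.Icc 1 t, Y τ ω := fun ω => by
      rw [← Finset.sum_apply, ← hsum]
    simp only [h]
    rw [integral_finsetSum _ fun τ hτ => (hYLp τ hτ).integrable (by norm_num)]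
    calc ∑ τ ∈ Finset.Icc 1 t, ∫ ω, Y τ ω ∂P = ∑ τ ∈ Finset.Icc 1 t, w τ * ∫ σ, f σ ∂PS := by
          refine Finset.sum_congr rfl fun τ hτ => ?_
          rw [hY, integral_const_mul, hint τ (Finset.mem_Icc.1 hτ).1]
      _ = _ := by rw [← Finset.sum_mul, hw1, one_mul]
  refine ⟨(hsumLp.sub (memLp_const _)).integrable_sq, ?_⟩
  rw [← hmean, ← variance_eq_integral hsumLp.aestronglyMeasurable.aemeasurable, hsum,
    IndepFun.variance_sum hYLp]
  · calc ∑ τ ∈ Finset.Icc 1 t, variance (Y τ) P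
        ≤ ∑ τ ∈ Finset.Icc 1 t, 1 / weightSum p t * w τ * B ^ 2 := by
          refine Finset.sum_le_sum fun τ hτ => ?_
          rw [Finset.mem_Icc] at hτ
          rw [hY, variance_const_mul]
          have h1 : variance (fun ω => f (X τ ω)) P ≤ B ^ 2 := by
            have := variance_le_sq_of_bounded (a := -B) (b := B) (μ := P)
              (X := fun ω => f (X τ ω))
              ((hae τ hτ.1).mono fun ω h => Set.mem_Icc.2 (abs_le.1 h))
              (hmeas τ hτ.1).aemeasurable
            refine this.trans (le_of_eq ?_)
            ring
          have h2 : w τ ≤ 1 / weightSum p t := by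
            rw [hw]
            refine mul_le_of_le_one_right (by positivity) ?_
            refine Real.rpow_le_one (by positivity) ?_ hp.le
            refine div_le_one_of_le₀ ?_ (by positivity)
            exact_mod_cast hτ.2
          have h3 : w τ ^ 2 ≤ 1 / weightSum p t * w τ := by
            rw [sq]
            exact mul_le_mul_of_nonneg_right h2 (hw0 τ)
          exact mul_le_mul h3 h1 (variance_nonneg _ _)
            (mul_nonneg (by positivity) (hw0 τ))
      _ = B ^ 2 / weightSum p t := by
          rw [← Finset.sum_mul, ← Finset.mul_sum, hw1]
          ring
  · intro i hi j hj hij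
    obtain ⟨i, rfl⟩ := Nat.exists_eq_add_of_le' (Finset.mem_Icc.1 hi).1
    obtain ⟨j, rfl⟩ := Nat.exists_eq_add_of_le' (Finset.mem_Icc.1 hj).1
    have h := hindep.indepFun (i := i) (j := j) (fun h => hij (by rw [h]))
    exact h.comp (φ := fun σ => w (i + 1) * f σ) (ψ := fun σ => w (j + 1) * f σ)
      (hf.const_mul _) (hf.const_mul _)

/-- The points of the cube `[-ρ, ρ]^ι` with coordinates in `(ρ / n) ℤ`. -/
def gridPoint {ι : Type*} (ρ : ℝ) (n : ℕ) (j : ι → Fin (2 * n + 1)) :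
    EuclideanSpace ℝ ι :=
  WithLp.toLp 2 fun i => ρ * ((((j i : ℕ) : ℝ) - n) / n)

lemma abs_gridPoint_le {ι : Type*} {ρ : ℝ} (hρ : 0 ≤ ρ) {n : ℕ} (hn : 1 ≤ n)
    (j : ι → Fin (2 * n + 1)) (i : ι) : |gridPoint ρ n j i| ≤ ρ := by
  have hn' : (0 : ℝ) < n := by exact_mod_cast hn
  have h : ((j i : ℕ) : ℝ) ≤ 2 * n := by exact_mod_cast Nat.lt_succ_iff.1 (j i).2
  have h0 : (0 : ℝ) ≤ ((j i : ℕ) : ℝ) := Nat.cast_nonneg _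
  change |ρ * ((((j i : ℕ) : ℝ) - n) / n)| ≤ ρ
  rw [abs_mul, abs_of_nonneg hρ]
  refine mul_le_of_le_one_right hρ ?_
  rw [abs_div, abs_of_pos hn', div_le_one hn', abs_le]
  constructor <;> linarith

lemma exists_gridPoint {ι : Type*} [Fintype ι] {ρ : ℝ} (hρ : 0 < ρ) {n : ℕ} (hn : 1 ≤ n)
    {e : EuclideanSpace ℝ ι} (he : ∀ i, |e i| ≤ ρ) :
    ∃ j : ι → Fin (2 * n + 1), ‖e - gridPoint ρ n j‖ ≤ Fintype.card ι * ρ / n := by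
  have hn' : (0 : ℝ) < n := by exact_mod_cast hn
  have hpos : ∀ i, 0 ≤ (e i / ρ + 1) * n := fun i => by
    have := (abs_le.1 (he i)).1
    have h2 : -1 ≤ e i / ρ := by rw [le_div_iff₀ hρ]; linarith
    exact mul_nonneg (by linarith) hn'.le
  have hfl : ∀ i, ⌊(e i / ρ + 1) * n⌋₊ < 2 * n + 1 := fun i => by
    rw [Nat.lt_succ_iff]
    refine Nat.floor_le_of_le ?_
    have := (abs_le.1 (he i)).2
    have h2 : e i / ρ ≤ 1 := by rw [div_le_iff₀ hρ]; linarith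
    push_cast
    exact mul_le_mul_of_nonneg_right (by linarith) hn'.le
  refine ⟨fun i => ⟨_, hfl i⟩, (norm_le_sum_abs _).trans ?_⟩
  calc _ ≤ ∑ _i : ι, ρ / n := by
        refine Finset.sum_le_sum fun i _ => ?_
        change |e i - ρ * (((⌊(e i / ρ + 1) * n⌋₊ : ℝ) - n) / n)| ≤ _
        have h1 := Nat.floor_le (hpos i)
        have h2 := (Nat.lt_floor_add_one ((e i / ρ + 1) * n)).le
        set m : ℝ := (⌊(e i / ρ + 1) * n⌋₊ : ℝ)
        have h3 : e i - ρ * ((m - n) / n) = ((e i / ρ + 1) * n - m) * (ρ / n) := by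
          field_simp
          ring
        rw [h3, abs_mul, abs_of_pos (div_pos hρ hn'), abs_of_nonneg (by linarith)]
        exact mul_le_of_le_one_left (by positivity) (by linarith)
    _ = _ := by
        rw [Finset.sum_const, Finset.card_univ, nsmul_eq_mul]
        ring

/-- A uniform law of large numbers over a cube: along the times `(k + 1) ^ (2 c + 4)`, `c` the
dimension, the uniform error is summable. In the `k`-th step the cube is replaced by a grid of mesh
`(k + 1)⁻²`, which has `O((k + 1) ^ (2 c))` points, at each of which the mean square error
is `O((k + 1) ^ (-(2 c + 4)))`. -/
theorem uniform_lln [IsProbabilityMeasure PS] {ι : Type*} [Fintype ι] {p : ℝ} (hp : 0 < p)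
    (hX : ∀ t, Measurable (X (t + 1))) (hlaw : ∀ t, P.map (X (t + 1)) = PS)
    (hindep : iIndepFun (fun t : ℕ => X (t + 1)) P)
    {φ : EuclideanSpace ℝ ι → S → ℝ} (hφ : ∀ e, Measurable (φ e)) {B K ρ : ℝ}
    (hρ : 0 < ρ) (hB : ∀ᵐ σ ∂PS, ∀ e, |φ e σ| ≤ B)
    (hK : ∀ᵐ σ ∂PS, ∀ e e', (∀ i, |e i| ≤ ρ) → (∀ i, |e' i| ≤ ρ) →
      |φ e σ - φ e' σ| ≤ K * ‖e - e'‖) :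
    ∀ᵐ ω ∂P, ∃ ε : ℕ → ℝ, Summable ε ∧ ∀ k e, (∀ i, |e i| ≤ ρ) →
      |wavg p ((k + 1) ^ (2 * Fintype.card ι + 4)) (fun τ => φ e (X τ ω)) - ∫ σ, φ e σ ∂PS|
        ≤ ε k := by
  classical
  set c := Fintype.card ι with hc
  set T : ℕ → ℕ := fun k => (k + 1) ^ (2 * c + 4) with hT
  set n : ℕ → ℕ := fun k => (k + 1) ^ 2 with hn
  have hT1 : ∀ k, 1 ≤ T k := fun k => one_le_blockStart _ k
  have hn1 : ∀ k, 1 ≤ n k := fun k => one_le_blockStart _ k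
  set F : EuclideanSpace ℝ ι → ℝ := fun e => ∫ σ, φ e σ ∂PS with hF
  set y : ℕ → EuclideanSpace ℝ ι → Ω → ℝ := fun k e ω =>
    wavg p (T k) (fun τ => φ e (X τ ω)) - F e with hy
  have hmoment := fun k e => integral_sq_wavg_sub_le (PS := PS) hp hX hlaw hindep (hφ e)
    (hB.mono fun σ h => h e) (hT1 k)
  set G : ℕ → Ω → ℝ := fun k ω =>
    ((k : ℝ) + 1) ^ 2 * ∑ j : ι → Fin (2 * n k + 1), y k (gridPoint ρ (n k) j) ω ^ 2 with hG
  have hsq : Summable fun k : ℕ => 1 / ((k : ℝ) + 1) ^ 2 := by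
    have := (summable_nat_add_iff (f := fun n : ℕ => 1 / (n : ℝ) ^ 2) 1).2
      (Real.summable_one_div_nat_pow.2 (by norm_num))
    simpa using this
  have hGint : ∀ k, Integrable (G k) P := fun k =>
    (integrable_finsetSum _ fun j _ => (hmoment k _).1).const_mul _
  have hGsum : ∀ᵐ ω ∂P, Summable fun k => G k ω := by
    refine ae_summable_of_integral_le (b := fun k : ℕ =>
      3 ^ c * B ^ 2 * 2 ^ (p + 1) * (1 / ((k : ℝ) + 1) ^ 2))
      (fun k ω => by positivity) hGint (fun k => ?_) (hsq.mul_left _)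
    have hk : (0 : ℝ) < (k : ℝ) + 1 := by positivity
    rw [hG, integral_const_mul, integral_finsetSum _ fun j _ => (hmoment k _).1]
    have h1 : B ^ 2 / weightSum p (T k) ≤ B ^ 2 * 2 ^ (p + 1) / ((k : ℝ) + 1) ^ (2 * c + 4) := by
      have h2 := weightSum_ge hp (T k)
      rw [Real.rpow_neg (by norm_num), inv_mul_le_iff₀ (by positivity)] at h2
      have h3 : ((T k : ℕ) : ℝ) = ((k : ℝ) + 1) ^ (2 * c + 4) := by simp [hT]
      rw [h3] at h2
      rw [div_le_div_iff₀ (weightSum_pos hp (hT1 k)) (by positivity)]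
      have := mul_le_mul_of_nonneg_left h2 (sq_nonneg B)
      linarith
    have h4 : ((2 * n k + 1 : ℕ) : ℝ) ≤ 3 * ((k : ℝ) + 1) ^ 2 := by
      simp only [hn]
      push_cast
      nlinarith [(Nat.cast_nonneg k : (0 : ℝ) ≤ k)]
    calc _ ≤ ((k : ℝ) + 1) ^ 2 * ∑ _j : ι → Fin (2 * n k + 1),
          B ^ 2 * 2 ^ (p + 1) / ((k : ℝ) + 1) ^ (2 * c + 4) := by
          gcongr with j
          exact (hmoment k _).2.trans h1
      _ = ((k : ℝ) + 1) ^ 2 * (((2 * n k + 1 : ℕ) : ℝ) ^ c *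
          (B ^ 2 * 2 ^ (p + 1) / ((k : ℝ) + 1) ^ (2 * c + 4))) := by
          rw [Finset.sum_const, Finset.card_univ, Fintype.card_fun, Fintype.card_fin,
            nsmul_eq_mul, Nat.cast_pow]
      _ ≤ ((k : ℝ) + 1) ^ 2 * ((3 * ((k : ℝ) + 1) ^ 2) ^ c *
          (B ^ 2 * 2 ^ (p + 1) / ((k : ℝ) + 1) ^ (2 * c + 4))) := by
          gcongr
      _ = _ := by
          rw [mul_pow, ← pow_mul, pow_add]
          field_simp
  have hgood : ∀ᵐ ω ∂P, ∀ t : ℕ, ∀ e e', (∀ i, |e i| ≤ ρ) → (∀ i, |e' i| ≤ ρ) →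
      |φ e (X (t + 1) ω) - φ e' (X (t + 1) ω)| ≤ K * ‖e - e'‖ := by
    rw [ae_all_iff]
    intro t
    refine ae_of_ae_map (hX t).aemeasurable (p := fun σ => ∀ e e', (∀ i, |e i| ≤ ρ) →
      (∀ i, |e' i| ≤ ρ) → |φ e σ - φ e' σ| ≤ K * ‖e - e'‖) ?_
    rw [hlaw]
    exact hK
  have hint : ∀ e, Integrable (φ e) PS := fun e =>
    Integrable.of_bound (hφ e).aestronglyMeasurable B (hB.mono fun σ h => h e)
  have hFlip : ∀ e e', (∀ i, |e i| ≤ ρ) → (∀ i, |e' i| ≤ ρ) → |F e - F e'| ≤ K * ‖e - e'‖ := by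
    intro e e' he he'
    rw [hF, ← integral_sub (hint e) (hint e')]
    have := norm_integral_le_of_norm_le_const (μ := PS) (f := fun σ => φ e σ - φ e' σ)
      (C := K * ‖e - e'‖) (hK.mono fun σ h => h e e' he he')
    simpa using this
  filter_upwards [hGsum, hgood] with ω hω1 hω2
  refine ⟨fun k => (2 * |K| * (c * ρ) + 1) * (1 / ((k : ℝ) + 1) ^ 2) + G k ω,
    (hsq.mul_left _).add hω1, fun k e he => ?_⟩
  obtain ⟨j, hj⟩ := exists_gridPoint hρ (hn1 k) he
  set z := gridPoint ρ (n k) j with hz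
  have hzρ : ∀ i, |z i| ≤ ρ := abs_gridPoint_le hρ.le (hn1 k) j
  have hk : (0 : ℝ) < (k : ℝ) + 1 := by positivity
  have h0 : K * ‖e - z‖ ≤ |K| * (c * ρ) * (1 / ((k : ℝ) + 1) ^ 2) := by
    calc K * ‖e - z‖ ≤ |K| * (c * ρ / (n k : ℕ)) :=
          mul_le_mul (le_abs_self K) hj (norm_nonneg _) (abs_nonneg _)
      _ = _ := by simp only [hn]; push_cast; ring
  have h1 : |wavg p (T k) (fun τ => φ e (X τ ω)) - wavg p (T k) (fun τ => φ z (X τ ω))|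
      ≤ K * ‖e - z‖ := by
    rw [← wavg_sub, ← Real.norm_eq_abs]
    refine norm_wavg_le hp (hT1 k) fun τ hτ _ => ?_
    obtain ⟨τ, rfl⟩ := Nat.exists_eq_add_of_le' hτ
    exact hω2 τ e z he hzρ
  have h2 := hFlip e z he hzρ
  -- `|y| ≤ δ + y² / δ` turns the mean square bound into a bound of the error itself
  have h3 : |y k z ω| ≤ 1 / ((k : ℝ) + 1) ^ 2 + ((k : ℝ) + 1) ^ 2 * y k z ω ^ 2 := by
    have hd : (0 : ℝ) < ((k : ℝ) + 1) ^ 2 := by positivity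
    rw [← sub_nonneg]
    have h5 : 1 / ((k : ℝ) + 1) ^ 2 + ((k : ℝ) + 1) ^ 2 * y k z ω ^ 2 - |y k z ω|
        = ((1 - ((k : ℝ) + 1) ^ 2 * |y k z ω|) ^ 2 + ((k : ℝ) + 1) ^ 2 * |y k z ω|)
          / ((k : ℝ) + 1) ^ 2 := by
      rw [← sq_abs (y k z ω)]
      field_simp
      ring
    rw [h5]
    positivity
  have h4 : ((k : ℝ) + 1) ^ 2 * y k z ω ^ 2 ≤ G k ω := by
    rw [hG]
    refine mul_le_mul_of_nonneg_left ?_ (by positivity)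
    exact Finset.single_le_sum (f := fun j => y k (gridPoint ρ (n k) j) ω ^ 2)
      (fun j _ => sq_nonneg _) (Finset.mem_univ j)
  have h6 : wavg p (T k) (fun τ => φ e (X τ ω)) - F e
      = (wavg p (T k) (fun τ => φ e (X τ ω)) - wavg p (T k) (fun τ => φ z (X τ ω)))
        + y k z ω - (F e - F z) := by
    simp only [hy]
    ring
  change |wavg p (T k) (fun τ => φ e (X τ ω)) - F e| ≤ _
  rw [h6]
  refine (abs_sub _ _).trans ?_
  have h7 := abs_add_le (wavg p (T k) (fun τ => φ e (X τ ω)) - wavg p (T k) (fun τ => φ z (X τ ω)))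
    (y k z ω)
  linarith

end UniformLLN

/-! ### The gradient steps of the algorithm -/

section Step

variable {N M L : ℕ}

lemma pad_natCast (hLN : L ≤ N) (g : Dict M L) (m : Fin M) (l : Fin L) :
    pad N g m ((l : ℕ) : ZMod N) = g (m, l) := by
  have h : ((l : ℕ) : ZMod N).val = l := ZMod.val_natCast_of_lt (l.2.trans_le hLN)
  simp [pad, h]

variable [NeZero N]

lemma surrogate_eq_wavg (lam p : ℝ) (s : ℕ → Signal N) (x : ℕ → Coef M N) (t : ℕ) (d : Dict M L) :
    surrogate lam p s x t d = wavg p t (fun τ => loss lam d (x τ) (s τ)) := by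
  simp [surrogate, wavg]

lemma gradient_surrogate (lam p : ℝ) (s : ℕ → Signal N) (x : ℕ → Coef M N) (t : ℕ)
    (d : Dict M L) :
    ∇ (surrogate lam p s x t) d = wavg p t (fun τ => lossGrad d (x τ) (s τ)) := by
  refine HasGradientAt.gradient ?_
  rw [hasGradientAt_iff_hasFDerivAt]
  have h1 : ∀ τ ∈ Finset.Icc 1 t, HasFDerivAt
      (fun d : Dict M L => ((τ : ℝ) / (t : ℝ)) ^ p * loss lam d (x τ) (s τ))
      (((τ : ℝ) / (t : ℝ)) ^ p •
        InnerProductSpace.toDual ℝ (Dict M L) (lossGrad d (x τ) (s τ))) d := fun τ _ =>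
    (hasGradientAt_loss lam d (x τ) (s τ)).hasFDerivAt.const_mul _
  refine ((HasFDerivAt.fun_sum h1).const_mul (1 / weightSum p t)).congr_fderiv ?_
  ext v
  rw [InnerProductSpace.toDual_apply_apply, inner_wavg]
  simp [wavg]

/-- The recursively updated accumulators give the weighted sum of the loss gradients. -/
lemma accA_mulVec_sub_accB (p : ℝ) (s : ℕ → Signal N) (x : ℕ → Coef M N) (g : Dict M L) (t : ℕ) :
    WithLp.toLp 2 ((accA L p x t).mulVec (fun q => g q) - accB L p s x t) =
      ∑ τ ∈ Finset.Icc 1 t, ((τ : ℝ) / (t : ℝ)) ^ p • lossGrad g (x τ) (s τ) := by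
  induction t with
  | zero => simp [accA, accB]
  | succ t ih =>
    rw [weighted_sum_succ, ← ih]
    have h : lossGrad g (x (t + 1)) (s (t + 1)) = WithLp.toLp 2
        (((operatorX L (x (t + 1))).transpose * operatorX L (x (t + 1))).mulVec (fun q => g q)
          - (operatorX L (x (t + 1))).transpose.mulVec (fun i => s (t + 1) i)) := by
      rw [← Matrix.mulVec_mulVec, ← Matrix.mulVec_sub]
      ext q
      simp only [lossGrad, Matrix.mulVec, dotProduct, Matrix.transpose_apply, operatorX,
        Pi.sub_apply, convSum_apply]
      refine Finset.sum_congr rfl fun i _ => ?_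
      rw [Fintype.sum_prod_type]
      congr 2
      refine Finset.sum_congr rfl fun m _ => Finset.sum_congr rfl fun l _ => ?_
      ring
    rw [h, accA, accB, ← WithLp.toLp_smul, ← WithLp.toLp_add, Matrix.add_mulVec, Matrix.smul_mulVec]
    congr 1
    rw [smul_sub]
    abel

lemma spatialStep_eq (p η : ℝ) (s : ℕ → Signal N) (x : ℕ → Coef M N) (t : ℕ) (g : Dict M L) :
    spatialStep p η s x t g = g - η • wavg p t (fun τ => lossGrad g (x τ) (s τ)) := by
  rw [spatialStep, accA_mulVec_sub_accB, wavg]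

/-- The discrete Fourier transform turns circular convolutions into products. -/
lemma dft_mul_dft (u v : ZMod N → ℂ) (k : ZMod N) :
    ZMod.dft u k * ZMod.dft v k = ZMod.dft (fun i => ∑ j, u j * v (i - j)) k := by
  simp only [ZMod.dft_apply, smul_eq_mul, Finset.mul_sum, Finset.sum_mul]
  symm
  rw [Finset.sum_comm]
  symm
  rw [Finset.sum_comm]
  refine Finset.sum_congr rfl fun j _ => ?_
  rw [← Equiv.sum_comp (Equiv.addRight j)
    (fun i => ZMod.stdAddChar (-(i * k)) * (u j * v (i - j)))]
  refine Finset.sum_congr rfl fun i _ => ?_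
  rw [Equiv.coe_addRight, add_sub_cancel_right, add_mul, neg_add, AddChar.map_add_eq_mul]
  ring

lemma star_dft_ofReal (u : ZMod N → ℝ) (k : ZMod N) :
    star (ZMod.dft (fun i => (u i : ℂ)) k) = ZMod.dft (fun i => (u (-i) : ℂ)) k := by
  simp only [ZMod.dft_apply, smul_eq_mul, star_sum, star_mul']
  rw [← Equiv.sum_comp (Equiv.neg (ZMod N))]
  refine Finset.sum_congr rfl fun i _ => ?_
  rw [Equiv.neg_apply, RCLike.star_def, ← AddChar.map_neg_eq_conj,
    Complex.conj_ofReal]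
  congr 2
  ring

/-- The discrete Fourier transform turns circular correlations into products with a conjugate. -/
lemma star_dft_mul_dft (u v : ZMod N → ℝ) (k : ZMod N) :
    star (ZMod.dft (fun i => (u i : ℂ)) k) * ZMod.dft (fun i => (v i : ℂ)) k =
      ZMod.dft (fun i => ((∑ j, u (j - i) * v j : ℝ) : ℂ)) k := by
  rw [star_dft_ofReal, dft_mul_dft]
  refine congrArg (fun w : ZMod N → ℂ => ZMod.dft w k) (funext fun i => ?_)
  rw [← Equiv.sum_comp (Equiv.subLeft i)]
  push_cast
  refine Finset.sum_congr rfl fun j _ => ?_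
  rw [Equiv.subLeft_apply, neg_sub, sub_sub_cancel]

lemma sum_pad_mul (hLN : L ≤ N) (g : Dict M L) (m : Fin M) (f : ZMod N → ℝ) :
    ∑ j, pad N g m j * f j = ∑ l : Fin L, g (m, l) * f ((l : ℕ) : ZMod N) := by
  symm
  refine Fintype.sum_of_injective (fun l : Fin L => ((l : ℕ) : ZMod N)) ?_ _ _ ?_ ?_
  · intro l l' h
    have := congrArg ZMod.val h
    simp only [ZMod.val_natCast_of_lt (l.2.trans_le hLN),
      ZMod.val_natCast_of_lt (l'.2.trans_le hLN)] at this
    exact Fin.ext this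
  · intro j hj
    have : ¬ j.val < L := fun h => hj ⟨⟨j.val, h⟩, by simp⟩
    simp [pad, this]
  · intro l
    rw [pad_natCast hLN]

lemma operatorXHat_mulVec (hLN : L ≤ N) (g : Dict M L) (x : Coef M N) :
    (operatorXHat x).mulVec (dictHat N g) =
      ZMod.dft (fun i => ((convSum g x i : ℝ) : ℂ)) := by
  ext k
  have h : ∀ i, ((convSum g x i : ℝ) : ℂ) =
      ∑ m : Fin M, ∑ j, ((pad N g m j : ℝ) : ℂ) * ((x (m, i - j) : ℝ) : ℂ) := fun i => by
    rw [convSum_apply]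
    push_cast
    refine Finset.sum_congr rfl fun m _ => ?_
    have := sum_pad_mul hLN g m (fun j => x (m, i - j))
    exact_mod_cast this.symm
  have h2 : (fun i => ((convSum g x i : ℝ) : ℂ)) =
      ∑ m : Fin M, fun i => ∑ j, ((pad N g m j : ℝ) : ℂ) * ((x (m, i - j) : ℝ) : ℂ) := by
    ext i
    rw [h, Finset.sum_apply]
  rw [h2, map_sum, Finset.sum_apply]
  simp only [Matrix.mulVec, dotProduct, operatorXHat, dictHat]
  rw [Fintype.sum_prod_type]
  refine Finset.sum_congr rfl fun m _ => ?_
  rw [← dft_mul_dft (fun j => ((pad N g m j : ℝ) : ℂ)) (fun j => ((x (m, j) : ℝ) : ℂ))]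
  simp only [ite_mul, zero_mul, Finset.sum_ite_eq, Finset.mem_univ, if_true]
  ring

/-- The gradient of the loss in the filters before it is restricted to their support: the
correlations of the coefficient maps with the residual. -/
def fullGrad (g : Dict M L) (x : Coef M N) (s : Signal N) (m : Fin M) (j : ZMod N) : ℝ :=
  ∑ i, x (m, i - j) * (convSum g x i - s i)

lemma operatorXHat_conjTranspose_mulVec (hLN : L ≤ N) (g : Dict M L) (x : Coef M N)
    (s : Signal N) (m : Fin M) (k : ZMod N) :
    (operatorXHat x).conjTranspose.mulVec ((operatorXHat x).mulVec (dictHat N g) - signalHat s)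
      (m, k) = ZMod.dft (fun j => ((fullGrad g x s m j : ℝ) : ℂ)) k := by
  rw [operatorXHat_mulVec hLN, signalHat, ← map_sub]
  have h : ((fun i => ((convSum g x i : ℝ) : ℂ)) - fun i => ((s i : ℝ) : ℂ)) =
      fun i => ((convSum g x i - s i : ℝ) : ℂ) := by
    ext i
    simp
  rw [h]
  simp only [Matrix.mulVec, dotProduct, Matrix.conjTranspose_apply, operatorXHat, fullGrad]
  rw [← star_dft_mul_dft (fun j => x (m, j)) (fun i => convSum g x i - s i)]
  rw [Finset.sum_eq_single k]
  · simp
  · intro b _ hb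
    simp [hb]
  · simp

lemma accAHat_mulVec_sub_accBHat (hLN : L ≤ N) (p : ℝ) (s : ℕ → Signal N) (x : ℕ → Coef M N)
    (g : Dict M L) (t : ℕ) (m : Fin M) :
    (fun k => ((accAHat p x t).mulVec (dictHat N g) - accBHat p s x t) (m, k)) =
      ZMod.dft (fun j => ((∑ τ ∈ Finset.Icc 1 t,
        ((τ : ℝ) / (t : ℝ)) ^ p • fullGrad g (x τ) (s τ) m j : ℝ) : ℂ)) := by
  induction t with
  | zero =>
    have h : (fun _ : ZMod N => (0 : ℂ)) = 0 := rfl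
    simp [accAHat, accBHat, h]
  | succ t ih =>
    have h1 : (fun j => ((∑ τ ∈ Finset.Icc 1 (t + 1),
        ((τ : ℝ) / ((t + 1 : ℕ) : ℝ)) ^ p • fullGrad g (x τ) (s τ) m j : ℝ) : ℂ)) =
        (forget p (t + 1) : ℂ) • (fun j => ((∑ τ ∈ Finset.Icc 1 t,
          ((τ : ℝ) / (t : ℝ)) ^ p • fullGrad g (x τ) (s τ) m j : ℝ) : ℂ))
        + fun j => ((fullGrad g (x (t + 1)) (s (t + 1)) m j : ℝ) : ℂ) := by
      ext j
      rw [weighted_sum_succ]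
      simp
    rw [h1, map_add, map_smul, ← ih]
    ext k
    rw [Pi.add_apply, ← operatorXHat_conjTranspose_mulVec hLN]
    simp only [accAHat, accBHat, Matrix.add_mulVec, Matrix.smul_mulVec, Matrix.mulVec_sub,
      Matrix.mulVec_mulVec, Pi.sub_apply, Pi.add_apply, Pi.smul_apply, smul_eq_mul]
    ring

/-- The gradient step computed in the frequency domain agrees with the one in the spatial
domain. -/
lemma freqStep_eq (hLN : L ≤ N) (p η : ℝ) (s : ℕ → Signal N) (x : ℕ → Coef M N) (t : ℕ)
    (g : Dict M L) :
    freqStep p η s x t g = g - η • wavg p t (fun τ => lossGrad g (x τ) (s τ)) := by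
  ext ⟨m, l⟩
  have h : (fun k : ZMod N => (dictHat N g - ((η * (1 / weightSum p t) : ℝ) : ℂ) •
        ((accAHat p x t).mulVec (dictHat N g) - accBHat p s x t)) (m, k)) =
      ZMod.dft ((fun j => ((pad N g m j : ℝ) : ℂ)) - ((η * (1 / weightSum p t) : ℝ) : ℂ) •
        fun j => ((∑ τ ∈ Finset.Icc 1 t,
          ((τ : ℝ) / (t : ℝ)) ^ p • fullGrad g (x τ) (s τ) m j : ℝ) : ℂ)) := by
    rw [map_sub, map_smul, ← accAHat_mulVec_sub_accBHat hLN]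
    rfl
  simp only [freqStep]
  rw [h, LinearEquiv.symm_apply_apply]
  simp only [Pi.sub_apply, Pi.smul_apply, smul_eq_mul, ← Complex.ofReal_mul, ← Complex.ofReal_sub,
    Complex.ofReal_re, pad_natCast hLN, PiLp.sub_apply, PiLp.smul_apply, wavg, fullGrad]
  have h2 : (∑ τ ∈ Finset.Icc 1 t, ((τ : ℝ) / (t : ℝ)) ^ p • lossGrad g (x τ) (s τ)) (m, l) =
      ∑ τ ∈ Finset.Icc 1 t, ((τ : ℝ) / (t : ℝ)) ^ p * ∑ i, x τ (m, i - ((l : ℕ) : ZMod N)) *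
        (convSum g (x τ) i - s τ i) := by
    simp [lossGrad]
  rw [h2]
  ring

lemma gradStep_eq (hLN : L ≤ N) (opt : UpdateOption) (p η : ℝ) (s : ℕ → Signal N)
    (x : ℕ → Coef M N) (t : ℕ) (g : Dict M L) :
    gradStep opt p η s x t g = g - η • wavg p t (fun τ => lossGrad g (x τ) (s τ)) := by
  cases opt
  · exact spatialStep_eq p η s x t g
  · exact freqStep_eq hLN p η s x t g

end Step

/-! ### The constraint set and the output of FISTA -/

section Fista

variable {M L : ℕ}

lemma norm_le_of_mem_constraintSet {d : Dict M L} (hd : d ∈ constraintSet M L) :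
    ‖d‖ ≤ (M : ℝ) + 1 := by
  have h : ‖d‖ ^ 2 ≤ M := by
    rw [EuclideanSpace.norm_sq_eq, Fintype.sum_prod_type]
    calc _ ≤ ∑ _m : Fin M, (1 : ℝ) :=
          Finset.sum_le_sum fun m _ => by simpa using hd m
      _ = M := by simp
  have hM : (0 : ℝ) ≤ M := Nat.cast_nonneg M
  exact (sq_le_sq₀ (norm_nonneg d) (by linarith)).1 (h.trans (by nlinarith))

lemma isCompact_constraintSet : IsCompact (constraintSet M L) := by
  refine Metric.isCompact_of_isClosed_isBounded ?_ ?_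
  · simp only [constraintSet, Set.ofPred_forall]
    exact isClosed_iInter fun m => isClosed_le (by fun_prop) continuous_const
  · exact isBounded_iff_forall_norm_le.2 ⟨_, fun d hd => norm_le_of_mem_constraintSet hd⟩

lemma convex_constraintSet : Convex ℝ (constraintSet M L) := by
  intro d hd e he a b ha hb hab m
  calc ∑ l : Fin L, (a • d + b • e) (m, l) ^ 2
      ≤ ∑ l : Fin L, (a * d (m, l) ^ 2 + b * e (m, l) ^ 2) := by
        refine Finset.sum_le_sum fun l _ => ?_
        simp only [PiLp.add_apply, PiLp.smul_apply, smul_eq_mul]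
        obtain rfl : b = 1 - a := by linarith
        nlinarith [mul_nonneg (mul_nonneg ha hb) (sq_nonneg (d (m, l) - e (m, l)))]
    _ = a * ∑ l : Fin L, d (m, l) ^ 2 + b * ∑ l : Fin L, e (m, l) ^ 2 := by
        rw [Finset.sum_add_distrib, Finset.mul_sum, Finset.mul_sum]
    _ ≤ a * 1 + b * 1 :=
        add_le_add (mul_le_mul_of_nonneg_left (hd m) ha) (mul_le_mul_of_nonneg_left (he m) hb)
    _ = 1 := by linarith

/-- The metric projection onto a nonempty compact convex set is characterized by its variational
inequality. -/
lemma metricProj_spec {E : Type*} [NormedAddCommGroup E] [InnerProductSpace ℝ E] {C : Set E}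
    (hC : IsCompact C) (hne : C.Nonempty) (hconv : Convex ℝ C) (y : E) :
    metricProj C y ∈ C ∧ ∀ e ∈ C, ⟪y - metricProj C y, e - metricProj C y⟫ ≤ 0 := by
  obtain ⟨z, hz, hmin⟩ := hC.exists_isMinOn hne
    (f := fun z => ‖y - z‖) (by fun_prop)
  have hspec : metricProj C y ∈ C ∧ ∀ w ∈ C, ‖y - metricProj C y‖ ≤ ‖y - w‖ :=
    Classical.epsilon_spec (p := fun z => z ∈ C ∧ ∀ w ∈ C, ‖y - z‖ ≤ ‖y - w‖)
      ⟨z, hz, fun w hw => hmin hw⟩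
  refine ⟨hspec.1, (norm_eq_iInf_iff_real_inner_le_zero hconv hspec.1).1 ?_⟩
  have : Nonempty C := ⟨⟨z, hz⟩⟩
  refine le_antisymm (le_ciInf fun w => hspec.2 w w.2) ?_
  exact ciInf_le (f := fun w : C => ‖y - w‖)
    ⟨0, by rintro _ ⟨w, rfl⟩; exact norm_nonneg _⟩ ⟨_, hspec.1⟩

/-- A point returned by FISTA for a function with `A`-Lipschitz gradient `G` satisfies the
variational inequality of the constrained problem up to a multiple of the tolerance. -/
lemma FistaOutput.approx_stationary {E : Type*} [NormedAddCommGroup E] [InnerProductSpace ℝ E]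
    {C : Set E} (hC : IsCompact C) (hne : C.Nonempty) (hconv : Convex ℝ C) {G : E → E} {A η : ℝ}
    (hη : 0 < η) (hG : ∀ g g', ‖G g - G g'‖ ≤ A * ‖g - g'‖) (hA : 0 ≤ A) {tol : ℝ} {g0 out : E}
    (h : FistaOutput (fun g => metricProj C (g - η • G g)) tol g0 out) :
    out ∈ C ∧ ∀ e ∈ C, -((1 / η + A) * tol) * ‖e - out‖ ≤ ⟪G out, e - out⟫ := by
  obtain ⟨j, -, htol, hout⟩ := h
  set b := (fista (fun g => metricProj C (g - η • G g)) g0 j).2 with hb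
  have hout' : out = metricProj C (b - η • G b) := hout
  have hspec := metricProj_spec hC hne hconv (b - η • G b)
  rw [← hout'] at hspec
  have htol' : ‖b - out‖ ≤ tol := by rw [hout']; exact htol
  refine ⟨hspec.1, fun e he => ?_⟩
  have h1 := hspec.2 e he
  have h2 : ⟪b - η • G b - out, e - out⟫ = ⟪b - out, e - out⟫ - η * ⟪G b, e - out⟫ := by
    rw [sub_right_comm, inner_sub_left, real_inner_smul_left]
  rw [h2] at h1
  have h3 := (abs_le.1 (abs_real_inner_le_norm (b - out) (e - out))).1
  have h4 := (abs_le.1 (abs_real_inner_le_norm (G out - G b) (e - out))).1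
  rw [inner_sub_left] at h4
  have h5 : ‖G out - G b‖ ≤ A * tol := by
    refine (hG _ _).trans ?_
    rw [norm_sub_rev]
    gcongr
  have hn := norm_nonneg (e - out)
  have h6 := mul_le_mul_of_nonneg_right h5 hn
  have h7 := mul_le_mul_of_nonneg_right htol' hn
  have h8 : -(1 / η * tol * ‖e - out‖) ≤ ⟪G b, e - out⟫ := by
    have h9 : -(tol * ‖e - out‖) / η ≤ ⟪G b, e - out⟫ := by
      rw [div_le_iff₀ hη]
      linarith
    calc _ = -(tol * ‖e - out‖) / η := by ring
      _ ≤ _ := h9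
  linarith

end Fista

/-! ### The trajectory of the algorithm -/

/-- Every run of the algorithm on bounded signals is a surrogate run: the constants come from the
uniform bound on the sparse codes, and the tolerance of FISTA is `O(1 / t)`. -/
lemma IsRun.exists_surrogateRun {N M L : ℕ} [NeZero N] (hLN : L ≤ N) {opt : UpdateOption}
    {lam p η τ₀ α : ℝ} (hlam : 0 < lam) (hp : 0 < p) (hη : 0 < η) (hτ₀ : 0 < τ₀) (hα : 0 < α)
    {d0 : Dict M L} (hd0 : d0 ∈ constraintSet M L)
    {s : ℕ → Signal N} {x : ℕ → Coef M N} {d : ℕ → Dict M L}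
    (hrun : IsRun opt lam p η τ₀ α d0 s x d) {R : ℝ} (hR0 : 0 ≤ R) (hR : ∀ t, ‖s (t + 1)‖ ≤ R)
    {μ : ℝ} (hμ : 0 < μ) (hconv : ∀ t : ℕ, 1 ≤ t → ∀ D D' : Dict M L,
      μ * ‖D - D'‖ ^ 2 ≤ ⟪∇ (surrogate lam p s x t) D - ∇ (surrogate lam p s x t) D', D - D'⟫) :
    ∃ K c : ℝ, SurrogateRun p K ((M : ℝ) + 1) c μ (constraintSet M L)
      (fun τ D => loss lam D (x τ) (s τ)) (fun τ D => minLoss lam D (s τ))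
      (fun τ D => lossGrad D (x τ) (s τ)) d := by
  set A := codeBound N M L lam R with hA
  have hA0 : 0 ≤ A := codeBound_nonneg hlam R
  set r : ℝ := (M : ℝ) + 1 with hr
  have hr0 : 0 < r := by positivity
  have hs : ∀ τ, 1 ≤ τ → ‖s τ‖ ≤ R := fun τ hτ => by
    obtain ⟨τ, rfl⟩ := Nat.exists_eq_add_of_le' hτ
    exact hR τ
  have hcode : ∀ τ, 1 ≤ τ → ∃ D : Dict M L, IsSparseCode lam D (s τ) (x τ) := fun τ hτ => by
    obtain ⟨τ, rfl⟩ := Nat.exists_eq_add_of_le' hτ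
    exact ⟨_, hrun.code τ⟩
  have hconvSum : ∀ τ, 1 ≤ τ → ∀ v : Dict M L, ‖convSum v (x τ)‖ ≤ A * ‖v‖ := fun τ hτ v => by
    obtain ⟨D, hD⟩ := hcode τ hτ
    exact hD.norm_convSum_le hlam (hs τ hτ) v
  have hstep : ∀ t, d (t + 1) ∈ constraintSet M L ∧ ∀ e ∈ constraintSet M L,
      -((1 / η + A ^ 2) * (τ₀ / (1 + α * ((t + 1 : ℕ) : ℝ)))) * ‖e - d (t + 1)‖ ≤
        ⟪wavg p (t + 1) (fun τ => lossGrad (d (t + 1)) (x τ) (s τ)), e - d (t + 1)⟫ := by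
    intro t
    have h := hrun.update t
    simp only [gradStep_eq hLN] at h
    refine FistaOutput.approx_stationary isCompact_constraintSet ⟨d0, hd0⟩ convex_constraintSet hη
      (G := fun g => wavg p (t + 1) (fun τ => lossGrad g (x τ) (s τ))) (fun g g' => ?_)
      (by positivity) h
    rw [← wavg_sub]
    exact norm_wavg_le hp (by omega) fun τ hτ _ =>
      norm_lossGrad_sub_le (hconvSum τ hτ) hA0 g g' (s τ)
  set K := 1 / 2 * (A * (3 * r) + R) ^ 2 + 1 / 2 * R ^ 2 + A * (2 * A * (3 * r) + R) + A ^ 2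
    with hK
  refine ⟨K, (1 / η + A ^ 2) * (τ₀ / α), ?_⟩
  have hK1 : 1 / 2 * (A * (3 * r) + R) ^ 2 + 1 / 2 * R ^ 2 ≤ K := by
    have : 0 ≤ A * (2 * A * (3 * r) + R) + A ^ 2 := by positivity
    linarith
  have hK2 : A * (2 * A * (3 * r) + R) ≤ K := by
    have : 0 ≤ 1 / 2 * (A * (3 * r) + R) ^ 2 + 1 / 2 * R ^ 2 + A ^ 2 := by positivity
    linarith
  have hK3 : A ^ 2 ≤ K := by
    have : 0 ≤ 1 / 2 * (A * (3 * r) + R) ^ 2 + 1 / 2 * R ^ 2 + A * (2 * A * (3 * r) + R) := by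
      positivity
    linarith
  exact {
    p_pos := hp
    K_nonneg := (sq_nonneg A).trans hK3
    c_nonneg := by positivity
    μ_pos := hμ
    norm_le := fun e he => norm_le_of_mem_constraintSet he
    mem := fun t => by
      cases t with
      | zero => rw [hrun.init]; exact hd0
      | succ t => exact (hstep t).1
    sample_nonneg := fun τ _ e => minLoss_nonneg hlam e (s τ)
    sample_le := fun τ _ e => minLoss_le hlam e (x τ) (s τ)
    sample_eq := fun t => ((hrun.code t).minLoss_eq hlam).symm
    sample_lip := fun τ hτ e e' he he' =>
      (abs_minLoss_sub_le hlam (hs τ hτ) he he').trans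
        (mul_le_mul_of_nonneg_right hK2 (norm_nonneg _))
    surr_le := fun τ hτ e he => by
      obtain ⟨D, hD⟩ := hcode τ hτ
      refine (hD.loss_le hlam (hs τ hτ) (ρ := 3 * r) ?_).trans hK1
      linarith [norm_le_of_mem_constraintSet he]
    grad_le := fun τ hτ e he => by
      refine (norm_lossGrad_le (hconvSum τ hτ) hA0 e (s τ)).trans (le_trans ?_ hK2)
      have h1 := norm_le_of_mem_constraintSet he
      have h2 : A * ‖e‖ ≤ A * (6 * r) := mul_le_mul_of_nonneg_left (by linarith) hA0
      exact mul_le_mul_of_nonneg_left (by linarith [hs τ hτ]) hA0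
    convex := fun τ _ e e' => by
      have h := loss_add lam e (e' - e) (x τ) (s τ)
      rw [add_sub_cancel] at h
      rw [h]
      linarith [sq_nonneg ‖convSum (e' - e) (x τ)‖]
    smooth := fun τ hτ e e' => by
      have h := loss_add lam e (e' - e) (x τ) (s τ)
      rw [add_sub_cancel] at h
      have h1 : ‖convSum (e' - e) (x τ)‖ ^ 2 ≤ (A * ‖e' - e‖) ^ 2 := by
        gcongr
        exact hconvSum τ hτ _
      have h2 := mul_le_mul_of_nonneg_right hK3 (sq_nonneg ‖e' - e‖)
      rw [h]
      linarith
    approx_min := fun t ht e he => by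
      obtain ⟨t, rfl⟩ := Nat.exists_eq_add_of_le' ht
      refine le_trans ?_ ((hstep t).2 e he)
      refine mul_le_mul_of_nonneg_right (neg_le_neg ?_) (norm_nonneg _)
      rw [mul_div_assoc, div_div]
      refine mul_le_mul_of_nonneg_left ?_ (by positivity)
      refine div_le_div_of_nonneg_left hτ₀.le (by positivity) ?_
      linarith
    strong := fun t ht e e' => by
      have := hconv t ht e e'
      rwa [gradient_surrogate, gradient_surrogate] at this }

/-- The uniform law of large numbers for the minimal losses of the signals. -/
lemma ae_exists_summable_minLoss {N M L : ℕ} [NeZero N] {Ω : Type*} [MeasurableSpace Ω]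
    {P : Measure Ω} [IsProbabilityMeasure P] {lam p : ℝ} (hlam : 0 < lam) (hp : 0 < p)
    {PS : Measure (Signal N)} [IsProbabilityMeasure PS] (hsupp : IsCompact PS.support)
    {s : ℕ → Ω → Signal N} (hs_meas : ∀ t, Measurable (s (t + 1)))
    (hs_law : ∀ t, P.map (s (t + 1)) = PS) (hs_indep : iIndepFun (fun t : ℕ => s (t + 1)) P)
    {ρ : ℝ} (hρ : 0 < ρ) :
    ∀ᵐ ω ∂P, ∃ ε : ℕ → ℝ, Summable ε ∧ ∀ k (e : Dict M L), ‖e‖ ≤ ρ →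
      |wavg p ((k + 1) ^ (2 * Fintype.card (Fin M × Fin L) + 4))
        (fun τ => minLoss lam e (s τ ω)) - expectedLoss lam PS e| ≤ ε k := by
  obtain ⟨R, -, hR⟩ := ae_norm_le_of_isCompact_support hsupp
  have h := uniform_lln (ι := Fin M × Fin L) hp hs_meas hs_law hs_indep
    (φ := fun e σ => minLoss lam e σ) (fun e => measurable_minLoss hlam e)
    (B := 1 / 2 * R ^ 2) (K := codeBound N M L lam R *
      (2 * codeBound N M L lam R * (∑ _i : Fin M × Fin L, ρ) + R)) hρ
    (hR.mono fun σ hσ e => by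
      rw [abs_of_nonneg (minLoss_nonneg hlam e σ)]
      exact (minLoss_le_norm hlam e σ).trans (by gcongr))
    (hR.mono fun σ hσ e e' he he' =>
      abs_minLoss_sub_le hlam hσ
        ((norm_le_sum_abs e).trans (Finset.sum_le_sum fun i _ => he i))
        ((norm_le_sum_abs e').trans (Finset.sum_le_sum fun i _ => he' i)))
  filter_upwards [h] with ω hω
  obtain ⟨ε, hε, hb⟩ := hω
  exact ⟨ε, hε, fun k e he => hb k e fun i => (abs_apply_le_norm e i).trans he⟩

end

end OCDL

theorem theorem4p5
    {N M L : ℕ} [NeZero N] (hLN : L ≤ N)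
    {Ω : Type*} [MeasurableSpace Ω] (P : Measure Ω) [IsProbabilityMeasure P]
    -- the parameters of the problem and of the algorithm
    (opt : UpdateOption) (lam p η τ₀ α : ℝ)
    (hlam : 0 < lam) (hp : 0 < p) (hη : 0 < η) (hτ₀ : 0 < τ₀) (hα : 0 < α)
    (d0 : Dict M L) (hd0 : d0 ∈ constraintSet M L)
    -- the signals are independent with common law `PS`, which has compact support
    (PS : Measure (Signal N)) [IsProbabilityMeasure PS]
    (hsupp : IsCompact PS.support)
    (s : ℕ → Ω → Signal N)
    (hs_meas : ∀ t, Measurable (s (t + 1)))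
    (hs_law : ∀ t, P.map (s (t + 1)) = PS)
    (hs_indep : iIndepFun (fun t : ℕ => s (t + 1)) P)
    -- the sequences generated by the algorithm
    (x : ℕ → Ω → Coef M N) (d : ℕ → Ω → Dict M L)
    (hrun : ∀ᵐ ω ∂P, IsRun opt lam p η τ₀ α d0
      (fun t => s t ω) (fun t => x t ω) (fun t => d t ω))
    -- sparse coding has a unique solution, uniformly, for all signals and for all dictionaries
    -- in the closure of the trajectory of the algorithm
    (κ : ℝ) (hκ : 0 < κ)
    (huniq : ∀ᵐ ω ∂P, ∀ D ∈ closure (Set.range fun t => d t ω), ∀ σ ∈ PS.support,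
      (∃! y : Coef M N, IsSparseCode lam D σ y) ∧
        ∀ y : Coef M N, IsSparseCode lam D σ y → GramBound κ D y)
    -- the surrogates are uniformly strongly convex
    (μ : ℝ) (hμ : 0 < μ)
    (hconv : ∀ᵐ ω ∂P, ∀ t : ℕ, 1 ≤ t → ∀ D D' : Dict M L,
      μ * ‖D - D'‖ ^ 2 ≤
        ⟪∇ (surrogate lam p (fun τ => s τ ω) (fun τ => x τ ω) t) D
          - ∇ (surrogate lam p (fun τ => s τ ω) (fun τ => x τ ω) t) D', D - D'⟫) :
    ∀ᵐ ω ∂P,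
      (∃ u : ℝ, Tendsto
        (fun t => surrogate lam p (fun τ => s τ ω) (fun τ => x τ ω) t (d t ω)) atTop (𝓝 u)) ∧
      Tendsto
        (fun t => surrogate lam p (fun τ => s τ ω) (fun τ => x τ ω) t (d t ω)
          - expectedLoss lam PS (d t ω)) atTop (𝓝 0) ∧
      (∃ u : ℝ, Tendsto (fun t => expectedLoss lam PS (d t ω)) atTop (𝓝 u)) ∧
      (stationaryPoints lam PS : Set (Dict M L)).Nonempty ∧
      Tendsto (fun t => Metric.infDist (d t ω) (stationaryPoints lam PS)) atTop (𝓝 0) := by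
  obtain ⟨R, hR0, hR⟩ := ae_norm_le_of_isCompact_support hsupp
  have hbound : ∀ᵐ ω ∂P, ∀ t, ‖s (t + 1) ω‖ ≤ R := by
    rw [ae_all_iff]
    intro t
    refine ae_of_ae_map (hs_meas t).aemeasurable (p := fun σ => ‖σ‖ ≤ R) ?_
    rw [hs_law]
    exact hR
  have hlln := ae_exists_summable_minLoss (M := M) (L := L) (ρ := 3 * ((M : ℝ) + 1)) hlam hp hsupp
    hs_meas hs_law hs_indep (by positivity)
  filter_upwards [hrun, huniq, hconv, hbound, hlln] with ω hrun huniq hconv hbound hlln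
  obtain ⟨K, c, H⟩ := hrun.exists_surrogateRun hLN hlam hp hη hτ₀ hα hd0 hR0 hbound hμ hconv
  obtain ⟨ε, hε, hF⟩ := hlln
  have hdim : 2 ≤ 2 * Fintype.card (Fin M × Fin L) + 4 := by omega
  obtain ⟨⟨u, hu⟩, hgap⟩ := H.tendsto_surr_along hdim hε hF
  have hV := H.tendsto_infDist hdim hε hF isCompact_constraintSet
    (fun q hq => differentiableAt_expectedLoss hlam hsupp fun σ hσ => (huniq q hq σ hσ).1)
    (V := stationaryPoints lam PS) fun q hq hd he => ⟨hq, hd, he⟩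
  simp only [surrogate_eq_wavg]
  refine ⟨⟨u, hu⟩, hgap, ⟨u, ?_⟩, hV⟩
  have h := hu.sub hgap
  simp only [sub_sub_cancel, sub_zero] at h
  exact h
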